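/- Let $\mathrm{SU}(2)$ be the group of $2\times 2$ complex unitary matrices of determinant $1$, with Lie algebra $\mathfrak{su}(2)$ spanned over $\mathbb{R}$ by $$X_0=\tfrac12\begin{pmatrix} i&0\\0&-i\end{pmatrix},\qquad X_1=\tfrac12\begin{pmatrix}0&1\\-1&0\end{pmatrix},\qquad X_2=\tfrac12\begin{pmatrix}0&i\\ i&0\end{pmatrix}.$$ Equip $\mathrm{SU}(2)$ with the left-invariant sub-Riemannian structure for which the left-invariant vector fields $X_1(q)=qX_1$ and $X_2(q)=qX_2$ form an orthonormal frame of the distribution, and let $$H:T^*\mathrm{SU}(2)\to\mathbb{R},\qquad H(q,\lambda)=\tfrac12\bigl(\langle\lambda,X_1(q)\rangle^2+\langle\lambda,X_2(q)\rangle^2\bigr)$$ be its Hamiltonian. Let $\sigma=d\theta$ be the exterior derivative of the tautological one-form $\theta$ of $T^*\mathrm{SU}(2)$, and let $\vec H$ be the Hamiltonian vector field of $H$, determined by $\sigma(\cdot,\vec H)=dH$. For $q\in\mathrm{SU}(2)$ let $\mathscr{A}_q\subseteq T_q^*\mathrm{SU}(2)$ be the set of covectors $\lambda_0$ for which the solution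 $\lambda(t)$ of $\dot\lambda=\vec H(\lambda)$ with $\lambda(0)=(q,\lambda_0)$ exists on $[0,1]$; the sub-Riemannian exponential map $\exp_q:\mathscr{A}_q\to\mathrm{SU}(2)$ sends $\lambda_0$ to the projection of $\lambda(1)$ to $\mathrm{SU}(2)$. A covector $\lambda_0\in\mathscr{A}_q$ is a conjugate covector if $\operatorname{Ker}(d_{\lambda_0}\exp_q)\neq\{0\}$; the set of these is denoted $\mathrm{Conj}_q(\mathrm{SU}(2))$. **Proposition.** Let $q\in\mathrm{SU}(2)$. Then $\exp_q$ is defined on all of $T_q^*\mathrm{SU}(2)$, that is, $\mathscr{A}_q=T_q^*\mathrm{SU}(2)$, and for every conjugate covector $\lambda_0\in\mathrm{Conj}_q(\mathrm{SU}(2))$ and every neighbourhood $U$ of $\lambda_0$ in $T_q^*\mathrm{SU}(2)$, the map $\exp_q$ is not injective on $U$. -/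

import Mathlib

open Set Topology

namespace SubRiemannianSU2

/-- Complex `2 × 2` matrices. -/
abbrev Mat2 : Type := Matrix (Fin 2) (Fin 2) ℂ

/-- The Lie group `SU(2)`. -/
abbrev SU2 : Type := Matrix.specialUnitaryGroup (Fin 2) ℂ

/-! ### The Lie algebra -/

/-- The basis `X₀ = ½ [[i, 0], [0, -i]]`, `X₁ = ½ [[0, 1], [-1, 0]]`, `X₂ = ½ [[0, i], [i, 0]]` of
the real vector space `su(2)` of traceless antihermitian matrices. -/
noncomputable def X : Fin 3 → Mat2 :=
  ![!![Complex.I / 2, 0; 0, -Complex.I / 2],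
    !![0, 1 / 2; -1 / 2, 0],
    !![0, Complex.I / 2; Complex.I / 2, 0]]

/-- The Lie algebra `su(2)`, in the coordinates given by the basis `X₀, X₁, X₂`. The Euclidean
inner product is the one that makes this basis orthonormal. -/
abbrev LieAlg : Type := EuclideanSpace ℝ (Fin 3)

/-- The matrix `a₀ X₀ + a₁ X₁ + a₂ X₂` of an element of the Lie algebra. -/
noncomputable def toMatrix (a : LieAlg) : Mat2 := ∑ i, (a i : ℂ) • X i

/-- Explicit form of `toMatrix`. -/
theorem toMatrix_eq (a : LieAlg) : toMatrix a =
    !![Complex.I * a 0 / 2, (a 1 + Complex.I * a 2) / 2;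
      (-a 1 + Complex.I * a 2) / 2, -(Complex.I * a 0 / 2)] := by
  ext i j
  fin_cases i <;> fin_cases j <;>
    simp [toMatrix, X, Fin.sum_univ_three, Matrix.sum_apply] <;> ring

/-- The matrices of the form `toMatrix a` are exactly the traceless antihermitian ones. -/
theorem exists_toMatrix_iff (A : Mat2) :
    (∃ a, toMatrix a = A) ↔ A.conjTranspose = -A ∧ A.trace = 0 := by
  constructor
  · rintro ⟨a, rfl⟩
    rw [toMatrix_eq]
    refine ⟨?_, by simp [Matrix.trace_fin_two]⟩
    ext i j
    fin_cases i <;> fin_cases j <;> simp [Matrix.conjTranspose_apply] <;> ring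
  · rintro ⟨h, ht⟩
    have h00 := congrFun (congrFun h 0) 0
    have h01 := congrFun (congrFun h 0) 1
    rw [Matrix.trace_fin_two] at ht
    simp only [Matrix.conjTranspose_apply, Matrix.neg_apply, Complex.ext_iff, Complex.star_def,
      Complex.conj_re, Complex.conj_im, Complex.neg_re, Complex.neg_im] at h00 h01
    simp only [Complex.ext_iff, Complex.add_re, Complex.add_im, Complex.zero_re,
      Complex.zero_im] at ht
    refine ⟨!₂[2 * (A 0 0).im, 2 * (A 0 1).re, 2 * (A 0 1).im], ?_⟩
    rw [toMatrix_eq]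
    ext i j
    fin_cases i <;> fin_cases j <;> simp [Complex.ext_iff] <;> grind

/-- The Lie bracket of `su(2)` in coordinates. -/
noncomputable def bracket (a b : LieAlg) : LieAlg :=
  !₂[a 1 * b 2 - a 2 * b 1, a 2 * b 0 - a 0 * b 2, a 0 * b 1 - a 1 * b 0]

/-- The Lie bracket is the commutator of matrices. -/
theorem toMatrix_bracket (a b : LieAlg) :
    toMatrix (bracket a b) = toMatrix a * toMatrix b - toMatrix b * toMatrix a := by
  simp only [toMatrix_eq, bracket]
  ext i j
  fin_cases i <;> fin_cases j <;> simp <;> ring_nf <;> simp <;> ring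

theorem exp_toMatrix_mem (a : LieAlg) :
    NormedSpace.exp (toMatrix a) ∈ Matrix.specialUnitaryGroup (Fin 2) ℂ := by
  obtain ⟨hA, hA'⟩ := (exists_toMatrix_iff _).mp ⟨a, rfl⟩
  generalize toMatrix a = A at hA hA' ⊢
  have hU : IsUnit (NormedSpace.exp A).det :=
    (Matrix.isUnit_iff_isUnit_det _).mp (Matrix.isUnit_exp A)
  have hneg : NormedSpace.exp (-A) * NormedSpace.exp A = 1 := by
    rw [Matrix.exp_neg]; exact Matrix.nonsing_inv_mul _ hU
  refine Matrix.mem_specialUnitaryGroup_iff.mpr ⟨?_, ?_⟩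
  · rw [Matrix.mem_unitaryGroup_iff', Matrix.star_eq_conjTranspose, ← Matrix.exp_conjTranspose, hA]
    exact hneg
  · let J : Mat2 := !![0, 1; -1, 0]
    have hJ : IsUnit J := by
      rw [Matrix.isUnit_iff_isUnit_det]; simp [J, Matrix.det_fin_two]
    have hJi : J⁻¹ = !![0, -1; 1, 0] := by
      refine Matrix.inv_eq_left_inv ?_
      ext i j; fin_cases i <;> fin_cases j <;> simp [J]
    have hconj : ∀ Y : Mat2, J * Y.transpose * J⁻¹ = Y.adjugate := by
      intro Y
      rw [hJi, Matrix.adjugate_fin_two]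
      ext i j
      rw [Matrix.mul_apply, Fin.sum_univ_two, Matrix.mul_apply, Matrix.mul_apply,
        Fin.sum_univ_two, Fin.sum_univ_two]
      fin_cases i <;> fin_cases j <;> simp [J]
    have hA2 : A.adjugate = -A := by
      rw [Matrix.trace_fin_two] at hA'
      rw [Matrix.adjugate_fin_two]
      ext i j; fin_cases i <;> fin_cases j <;> simp <;> linear_combination hA'
    have h1 : NormedSpace.exp (-A) = (NormedSpace.exp A).adjugate := by
      rw [← hA2, ← hconj, Matrix.exp_conj _ _ hJ, Matrix.exp_transpose, hconj]
    rw [h1, Matrix.adjugate_mul] at hneg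
    simpa using congrFun (congrFun hneg 0) 0

/-- The exponential map `su(2) → SU(2)` of the Lie group. -/
noncomputable def lieExp (a : LieAlg) : SU2 := ⟨NormedSpace.exp (toMatrix a), exp_toMatrix_mem a⟩

/-! ### The cotangent bundle and its canonical symplectic form -/

/-- The dual `su(2)*`, in the coordinates dual to the basis `X₀, X₁, X₂` (equivalently, identified
with `su(2)` through the inner product). Through left translation it is identified with every
cotangent space `T*_q SU(2)`: the covector `μ` at `q` takes the value `⟪μ, a⟫` on the tangent
vector `q (a₀ X₀ + a₁ X₁ + a₂ X₂)`. -/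
abbrev Covector : Type := EuclideanSpace ℝ (Fin 3)

/-- The pairing of covectors and vectors. -/
noncomputable def pairing (μ : Covector) (a : LieAlg) : ℝ := ∑ i, μ i * a i

/-- The cotangent bundle `T* SU(2) ≅ SU(2) × su(2)*`, trivialised by left translations. -/
abbrev CotBundle : Type := SU2 × Covector

/-- The tangent spaces of `T* SU(2) ≅ SU(2) × su(2)*`, again trivialised by left translations: the
pair `(a, α)` at `(q, μ)` is the velocity at `s = 0` of the curve `s ↦ (q exp(s a), μ + s α)`. -/
abbrev TanCot : Type := LieAlg × Covector

/-- The derivative `V(F)` of the function `F` at the point `x` along the tangent vector `V`. If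
`x` varies and `V` is fixed, `V` is a left-invariant vector field on the Lie group
`SU(2) × su(2)*`. -/
noncomputable def dirDeriv (V : TanCot) (F : CotBundle → ℝ) (x : CotBundle) : ℝ :=
  deriv (fun s : ℝ => F (x.1 * lieExp (s • V.1), x.2 + s • V.2)) 0

/-- The tautological (Liouville) one-form of `T* SU(2)`: at `(q, μ)` it sends a tangent vector `V`
to `⟨μ, dπ V⟩`. -/
noncomputable def tautologicalForm (x : CotBundle) (V : TanCot) : ℝ := pairing x.2 V.1

/-- The Lie bracket of two left-invariant vector fields of the Lie group `SU(2) × su(2)*` (the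
second factor is abelian). -/
noncomputable def fieldBracket (V W : TanCot) : TanCot := (bracket V.1 W.1, 0)

/-- The exterior derivative of a one-form `ω` on `T* SU(2)`, evaluated on left-invariant vector
fields: `dω(V, W) = V(ω(W)) - W(ω(V)) - ω([V, W])`. -/
noncomputable def extDer (ω : CotBundle → TanCot → ℝ) (x : CotBundle) (V W : TanCot) : ℝ :=
  dirDeriv V (fun y => ω y W) x - dirDeriv W (fun y => ω y V) x - ω x (fieldBracket V W)

/-- The canonical symplectic form of `T* SU(2)`. -/
noncomputable def symplecticForm : CotBundle → TanCot → TanCot → ℝ := extDer tautologicalForm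

/-- `V` is the value at `x` of the Hamiltonian vector field of `F`: `σ(·, V) = d_x F`. -/
def IsHamiltonianVector (F : CotBundle → ℝ) (x : CotBundle) (V : TanCot) : Prop :=
  ∀ W : TanCot, symplecticForm x W V = dirDeriv W F x

/-! ### The sub-Riemannian structure of `SU(2)` -/

/-- The sub-Riemannian Hamiltonian `H(q, μ) = ½ (⟨μ, X₁(q)⟩² + ⟨μ, X₂(q)⟩²)` of the structure for
which the left-invariant vector fields `X₁(q) = q X₁` and `X₂(q) = q X₂` are an orthonormal frame of
the distribution. -/
noncomputable def hamiltonian (x : CotBundle) : ℝ :=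
  (pairing x.2 (EuclideanSpace.single 1 1) ^ 2 + pairing x.2 (EuclideanSpace.single 2 1) ^ 2) / 2

/-- `c` restricted to `[0, 1]` is a solution of Hamilton's equation `ċ = H⃗(c)`. The velocity of
`c = (q, μ)` is the pair `V = (a, α)` with `q̇ = q (a₀ X₀ + a₁ X₁ + a₂ X₂)` (entrywise) and
`μ̇ = α`. -/
def IsNormalExtremal (c : ℝ → CotBundle) : Prop :=
  ∀ t ∈ Icc (0 : ℝ) 1, ∃ V : TanCot, IsHamiltonianVector hamiltonian (c t) V ∧
    (∀ i j, HasDerivWithinAt (fun s => ((c s).1 : Mat2) i j)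
      ((((c t).1 : Mat2) * toMatrix V.1) i j) (Icc 0 1) t) ∧
    HasDerivWithinAt (fun s => (c s).2) V.2 (Icc 0 1) t

/-- The domain of `exp_q`: the covectors at `q` whose normal extremal exists on all of `[0, 1]`. -/
def expDomain (q : SU2) : Set Covector := {μ | ∃ c, IsNormalExtremal c ∧ c 0 = (q, μ)}

open Classical in
/-- The sub-Riemannian exponential map `exp_q(μ) = π(e^{H⃗}(q, μ))` on its domain (elsewhere the
value is irrelevant): the end point at time `1` of the projection to `SU(2)` of the normal
extremal that starts at `(q, μ)`. -/
noncomputable def srExp (q : SU2) (μ : Covector) : SU2 :=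
  if h : μ ∈ expDomain q then (h.choose 1).1 else 1

/-- The differential `d_μ exp_q`, followed by the (injective) differential of the embedding of
`SU(2)` into the space of matrices (arrays of complex numbers). -/
noncomputable def srExpDifferential (q : SU2) (μ : Covector) :
    Covector →L[ℝ] (Fin 2 → Fin 2 → ℂ) :=
  fderiv ℝ (fun ν i j => (srExp q ν : Mat2) i j) μ

/-- The conjugate locus at `q`: the covectors at which the differential of `exp_q` has a
nontrivial kernel. -/
def conjugateLocus (q : SU2) : Set Covector :=
  {μ | μ ∈ expDomain q ∧ ∃ v : Covector, v ≠ 0 ∧ srExpDifferential q μ v = 0}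

end SubRiemannianSU2

namespace SubRiemannianSU2

/-! In the left trivialisation Hamilton's equation is solvable explicitly. The vertical component `μ
0` is constant, the horizontal part `z = μ 1 + i μ 2` rotates with angular velocity `μ 0`, and the
trajectory from the identity is `exp (t (μ 0 X₀ + μ 1 X₁ + μ 2 X₂)) * exp (-t μ 0 X₀)`. This gives
completeness and, by uniqueness, a formula for the exponential map (`srExp_eq`).

Put `x = μ 0 / 2` and `w = |μ| / 2`. The endpoint has first row `A = (cos w + i x sin w / w)
e^{-ix}`, `B = (z / 2) (sin w / w) e^{ix}`. Here `A` depends on `(x, w)` only (`planarMap`), and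
`|B|` is determined by `A`. The phase of `z` can be adjusted to fix that of `B`, so double points of
the planar map lift to double points of the exponential map (`not_injOn_srExp_of_planarMap`).

If `z = 0` the map is constant along the vertical line; if `sin w = 0` and `z ≠ 0` it is constant on
a circle of rotated `z`. Elsewhere a kernel vector forces `sin w = w cos w`
(`critical_of_mem_conjugateLocus`). At such a point with `x ≠ 0` the planar map folds: along a level
curve of `|A|` the argument has derivative of the sign of `1 - w cot w`, which changes there. At `x
= 0` there is a cusp, and the reflection `x ↦ -x`, which conjugates `A`, identifies pairs of nearby
points where `A` is real. -/

/-! ### Hamilton's equation in the left trivialisation -/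

theorem dirDeriv_pairing (V : TanCot) (a : LieAlg) (x : CotBundle) :
    dirDeriv V (fun y => pairing y.2 a) x = pairing V.2 a := by
  have h : HasDerivAt (fun s : ℝ => pairing (x.2 + s • V.2) a) (pairing V.2 a) 0 := by
    have : (fun s : ℝ => pairing (x.2 + s • V.2) a) =
        fun s : ℝ => pairing x.2 a + s * pairing V.2 a := by
      ext s
      simp [pairing, Fin.sum_univ_three]
      ring
    rw [this]
    simpa using ((hasDerivAt_id (0 : ℝ)).mul_const (pairing V.2 a)).const_add (pairing x.2 a)
  exact h.deriv

theorem symplecticForm_apply (x : CotBundle) (V W : TanCot) :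
    symplecticForm x V W =
      pairing V.2 W.1 - pairing W.2 V.1 - pairing x.2 (bracket V.1 W.1) := by
  simp only [symplecticForm, extDer, tautologicalForm, dirDeriv_pairing, fieldBracket]

theorem hamiltonian_apply (x : CotBundle) :
    hamiltonian x = (x.2 1 ^ 2 + x.2 2 ^ 2) / 2 := by
  simp [hamiltonian, pairing]

theorem dirDeriv_hamiltonian (V : TanCot) (x : CotBundle) :
    dirDeriv V hamiltonian x = x.2 1 * V.2 1 + x.2 2 * V.2 2 := by
  have h : HasDerivAt (fun s : ℝ => hamiltonian (x.1 * lieExp (s • V.1), x.2 + s • V.2))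
      (x.2 1 * V.2 1 + x.2 2 * V.2 2) 0 := by
    have hi : ∀ i, HasDerivAt (fun s : ℝ => x.2 i + s * V.2 i) (V.2 i) 0 := fun i => by
      simpa using ((hasDerivAt_id (0 : ℝ)).mul_const (V.2 i)).const_add (x.2 i)
    simp only [hamiltonian_apply, PiLp.add_apply, PiLp.smul_apply, smul_eq_mul]
    refine ((((hi 1).fun_pow 2).fun_add ((hi 2).fun_pow 2)).div_const 2).congr_deriv ?_
    simp
    ring
  exact h.deriv

/-- The Hamiltonian vector field in the left trivialisation. -/
theorem isHamiltonianVector_iff (x : CotBundle) (V : TanCot) :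
    IsHamiltonianVector hamiltonian x V ↔
      V = (!₂[0, x.2 1, x.2 2], !₂[0, -(x.2 0 * x.2 2), x.2 0 * x.2 1]) := by
  simp only [IsHamiltonianVector, symplecticForm_apply, dirDeriv_hamiltonian]
  constructor
  · intro h
    -- Covector directions determine the velocity in the group; group directions then determine the
    -- rate of the covector through the bracket term.
    have h1 := fun i => h (0, EuclideanSpace.single i 1)
    have h2 := fun i => h (EuclideanSpace.single i 1, 0)
    have h10 := h1 0
    have h11 := h1 1
    have h12 := h1 2
    have h20 := h2 0
    have h21 := h2 1
    have h22 := h2 2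
    simp [pairing, Fin.sum_univ_three, bracket] at h10 h11 h12 h20 h21 h22
    refine Prod.ext ?_ ?_
    · ext i
      fin_cases i <;> simp [h10, h11, h12]
    · rw [h10, h11] at h22
      rw [h10, h12] at h21
      rw [h11, h12] at h20
      ext i
      fin_cases i <;> simp <;> linarith
  · rintro rfl W
    simp [pairing, Fin.sum_univ_three, bracket]
    ring

/-- Hamilton's equation in coordinates. -/
theorem isNormalExtremal_iff (c : ℝ → CotBundle) :
    IsNormalExtremal c ↔ ∀ t ∈ Icc (0 : ℝ) 1,
      (∀ i j, HasDerivWithinAt (fun s => ((c s).1 : Mat2) i j)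
        ((((c t).1 : Mat2) * toMatrix !₂[0, (c t).2 1, (c t).2 2]) i j) (Icc 0 1) t) ∧
      HasDerivWithinAt (fun s => (c s).2 0) 0 (Icc 0 1) t ∧
      HasDerivWithinAt (fun s => (c s).2 1) (-((c t).2 0 * (c t).2 2)) (Icc 0 1) t ∧
      HasDerivWithinAt (fun s => (c s).2 2) ((c t).2 0 * (c t).2 1) (Icc 0 1) t := by
  simp only [IsNormalExtremal, isHamiltonianVector_iff, exists_eq_left]
  refine forall₂_congr fun t _ => and_congr_right fun _ => ?_
  rw [hasDerivWithinAt_iff_hasFDerivWithinAt, hasFDerivWithinAt_euclidean]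
  simp only [ContinuousLinearMap.comp_toSpanSingleton, ← hasDerivWithinAt_iff_hasFDerivWithinAt]
  constructor
  · intro h
    exact ⟨by simpa using h 0, by simpa using h 1, by simpa using h 2⟩
  · rintro ⟨h0, h1, h2⟩ i
    fin_cases i <;> simpa

/-! ### Uniqueness of normal extremals -/

theorem eq_of_hasDerivWithinAt_zero {E : Type*} [NormedAddCommGroup E] [NormedSpace ℝ E]
    {f : ℝ → E} (hf : ∀ t ∈ Icc (0 : ℝ) 1, HasDerivWithinAt f 0 (Icc 0 1) t) :
    ∀ t ∈ Icc (0 : ℝ) 1, f t = f 0 := by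
  refine constant_of_has_deriv_right_zero (fun t ht => (hf t ht).continuousWithinAt) ?_
  intro t ht
  exact (hf t (Ico_subset_Icc_self ht)).mono_of_mem_nhdsWithin (Icc_mem_nhdsGE_of_mem ht)

theorem star_toMatrix (a : LieAlg) : star (toMatrix a) = -toMatrix a :=
  ((exists_toMatrix_iff _).mp ⟨a, rfl⟩).1

/-- Normal extremals are determined by their initial point. -/
theorem IsNormalExtremal.unique {c d : ℝ → CotBundle} (hc : IsNormalExtremal c)
    (hd : IsNormalExtremal d) (h0 : c 0 = d 0) : ∀ t ∈ Icc (0 : ℝ) 1, c t = d t := by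
  rw [isNormalExtremal_iff] at hc hd
  have hc0 := eq_of_hasDerivWithinAt_zero fun t ht => (hc t ht).2.1
  have hd0 := eq_of_hasDerivWithinAt_zero fun t ht => (hd t ht).2.1
  have hcd0 : ∀ t ∈ Icc (0 : ℝ) 1, (c t).2 0 = (d t).2 0 := fun t ht => by
    rw [hc0 t ht, hd0 t ht, h0]
  -- Both horizontal parts rotate with the same angular velocity, so their distance is conserved.
  have hdist := eq_of_hasDerivWithinAt_zero
    (f := fun t => ((c t).2 1 - (d t).2 1) ^ 2 + ((c t).2 2 - (d t).2 2) ^ 2) fun t ht => by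
      obtain ⟨-, -, c1, c2⟩ := hc t ht
      obtain ⟨-, -, d1, d2⟩ := hd t ht
      convert ((c1.fun_sub d1).fun_pow 2).fun_add ((c2.fun_sub d2).fun_pow 2) using 1
      rw [hcd0 t ht]
      simp
      ring
  have hcov : ∀ t ∈ Icc (0 : ℝ) 1, (c t).2 = (d t).2 := fun t ht => by
    have h := hdist t ht
    simp only [h0, sub_self] at h
    ext i
    fin_cases i
    · exact hcd0 t ht
    · simp only [Fin.mk_one]; nlinarith
    · simp only [Fin.reduceFinMk]; nlinarith
  -- Both trajectories now solve `q' = q Z` with the same antihermitian `Z`, so the two terms of the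
  -- derivative of `c d*` cancel.
  have hprod : ∀ i j, ∀ t ∈ Icc (0 : ℝ) 1,
      (((c t).1 : Mat2) * star ((d t).1 : Mat2)) i j =
        (((c 0).1 : Mat2) * star ((d 0).1 : Mat2)) i j := fun i j => by
    refine eq_of_hasDerivWithinAt_zero
      (f := fun t => (((c t).1 : Mat2) * star ((d t).1 : Mat2)) i j) fun t ht => ?_
    have hC := (hc t ht).1 i
    have hD := (hd t ht).1 j
    rw [← hcov t ht] at hD
    set Z := toMatrix !₂[0, (c t).2 1, (c t).2 2] with hZ
    have key : (((c t).1 : Mat2) * Z * star ((d t).1 : Mat2)) i j +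
        (((c t).1 : Mat2) * star (((d t).1 : Mat2) * Z)) i j = 0 := by
      rw [star_mul, hZ, star_toMatrix, ← Matrix.add_apply]
      simp [mul_assoc]
    rw [← key]
    simp only [Matrix.mul_apply (M := ((c _).1 : Mat2)) (N := star _),
      Matrix.mul_apply (M := ((c _).1 : Mat2) * Z) (N := star _), ← Finset.sum_add_distrib,
      Matrix.star_apply]
    exact HasDerivWithinAt.fun_sum fun k _ => (hC k).fun_mul (hD k).star
  intro t ht
  refine Prod.ext (Subtype.ext ?_) (hcov t ht)
  have h1 : ((c t).1 : Mat2) * star ((d t).1 : Mat2) = 1 := by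
    ext i j
    rw [hprod i j t ht, h0]
    exact congrFun (congrFun (Matrix.mem_unitaryGroup_iff.mp
      (Matrix.mem_specialUnitaryGroup_iff.mp (d 0).1.2).1) i) j
  have h2 : star ((d t).1 : Mat2) * ((d t).1 : Mat2) = 1 :=
    Matrix.mem_unitaryGroup_iff'.mp (Matrix.mem_specialUnitaryGroup_iff.mp (d t).1.2).1
  calc ((c t).1 : Mat2) = (c t).1 * (star ((d t).1 : Mat2) * ((d t).1 : Mat2)) := by
        rw [h2, mul_one]
    _ = (d t).1 := by rw [← mul_assoc, h1, one_mul]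

/-! ### Explicit extremals -/

/-- Half the norm of a covector. -/
noncomputable def halfNorm (μ : Covector) : ℝ := √(μ 0 ^ 2 + μ 1 ^ 2 + μ 2 ^ 2) / 2

theorem halfNorm_nonneg (μ : Covector) : 0 ≤ halfNorm μ := by
  unfold halfNorm; positivity

theorem four_mul_halfNorm_sq (μ : Covector) :
    4 * halfNorm μ ^ 2 = μ 0 ^ 2 + μ 1 ^ 2 + μ 2 ^ 2 := by
  rw [halfNorm, div_pow, Real.sq_sqrt (by positivity)]
  ring

/-- The first entry of the first row of the extremal trajectory from `1` with covector `μ`. -/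
noncomputable def trajA (μ : Covector) (t : ℝ) : ℂ :=
  (Real.cos (halfNorm μ * t) + Complex.I * (μ 0 / 2) * (Real.sin (halfNorm μ * t) / halfNorm μ)) *
    Complex.exp (-(Complex.I * (μ 0 / 2 * t)))

/-- The second entry of the first row of the extremal trajectory from `1` with covector `μ`. -/
noncomputable def trajB (μ : Covector) (t : ℝ) : ℂ :=
  (μ 1 + Complex.I * μ 2) / 2 * (Real.sin (halfNorm μ * t) / halfNorm μ) *
    Complex.exp (Complex.I * (μ 0 / 2 * t))

/-- The horizontal part of the covector of the extremal, as a complex number. -/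
noncomputable def trajZ (μ : Covector) (t : ℝ) : ℂ :=
  (μ 1 + Complex.I * μ 2) * Complex.exp (Complex.I * (μ 0 * t))

theorem halfNorm_eq_zero {μ : Covector} (h : halfNorm μ = 0) : μ = 0 := by
  have h4 := four_mul_halfNorm_sq μ
  rw [h] at h4
  ext i
  fin_cases i <;> simp <;> nlinarith [sq_nonneg (μ 0), sq_nonneg (μ 1), sq_nonneg (μ 2)]

theorem star_exp_I_mul (x : ℝ) :
    star (Complex.exp (Complex.I * x)) = Complex.exp (-(Complex.I * x)) := by
  rw [Complex.star_def, ← Complex.exp_conj]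
  simp

theorem star_exp_neg_I_mul (x : ℝ) :
    star (Complex.exp (-(Complex.I * x))) = Complex.exp (Complex.I * x) := by
  rw [← star_exp_I_mul, star_star]

theorem exp_neg_mul_exp (z : ℂ) : Complex.exp (-z) * Complex.exp z = 1 := by
  rw [← Complex.exp_add, neg_add_cancel, Complex.exp_zero]

/-- The phases cancel, leaving `cos² + (sin / w)² (μ 0² + μ 1² + μ 2²) / 4` at `w t`, and the last
factor is `w²`. -/
theorem trajA_star_add_trajB_star (μ : Covector) (t : ℝ) :
    trajA μ t * star (trajA μ t) + trajB μ t * star (trajB μ t) = 1 := by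
  -- At `μ = 0` the quotient `sin / w` takes the default value `0`, which is harmless because its
  -- coefficients vanish.
  rcases eq_or_ne (halfNorm μ) 0 with h | h
  · simp [trajA, trajB, halfNorm_eq_zero h, halfNorm]
  have e : (μ 0 / 2 * t : ℂ) = ((μ 0 / 2 * t : ℝ) : ℂ) := by push_cast; ring
  have h4 := four_mul_halfNorm_sq μ
  have hcs := Real.cos_sq_add_sin_sq (halfNorm μ * t)
  rw [trajA, trajB, e]
  generalize halfNorm μ = w at *
  generalize Real.cos (w * t) = C at *
  -- Taking `sin / w` as the variable turns the claim into a polynomial identity.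
  have hS : Real.sin (w * t) = Real.sin (w * t) / w * w := by field_simp
  rw [hS] at hcs
  simp only [star_mul', star_exp_I_mul, star_exp_neg_I_mul]
  have hE := exp_neg_mul_exp (Complex.I * ((μ 0 / 2 * t : ℝ) : ℂ))
  generalize Complex.exp (-(Complex.I * ((μ 0 / 2 * t : ℝ) : ℂ))) = E' at *
  generalize Complex.exp (Complex.I * ((μ 0 / 2 * t : ℝ) : ℂ)) = E at *
  rw [← Complex.ofReal_div]
  generalize Real.sin (w * t) / w = S at *
  have h4' : 4 * (w : ℂ) ^ 2 = μ 0 ^ 2 + μ 1 ^ 2 + μ 2 ^ 2 := by exact_mod_cast h4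
  have hcs' : (C : ℂ) ^ 2 + (S * w) ^ 2 = 1 := by exact_mod_cast hcs
  simp
  have hI := Complex.I_sq
  generalize (Complex.I) = I at *
  linear_combination (C ^ 2 + S ^ 2 * (μ 0 ^ 2 + μ 1 ^ 2 + μ 2 ^ 2) / 4) * hE
    - E * E' * S ^ 2 / 4 * (μ 0 ^ 2 + μ 2 ^ 2) * hI + hcs' - S ^ 2 / 4 * h4'

theorem hasDerivAt_ofReal_cos (w t : ℝ) :
    HasDerivAt (fun s : ℝ => (Real.cos (w * s) : ℂ)) (-(Real.sin (w * t) * w : ℂ)) t := by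
  have h := (((hasDerivAt_id t).const_mul w).cos).ofReal_comp
  refine h.congr_deriv ?_
  simp

theorem hasDerivAt_ofReal_sin_div {w : ℝ} (hw : w ≠ 0) (t : ℝ) :
    HasDerivAt (fun s : ℝ => (Real.sin (w * s) / w : ℂ)) (Real.cos (w * t) : ℂ) t := by
  have h := (((hasDerivAt_id t).const_mul w).sin).ofReal_comp.div_const (w : ℂ)
  refine h.congr_deriv ?_
  have : (w : ℂ) ≠ 0 := by exact_mod_cast hw
  simp [this]

theorem hasDerivAt_cexp_mul (k : ℂ) (t : ℝ) :
    HasDerivAt (fun s : ℝ => Complex.exp (k * s)) (k * Complex.exp (k * t)) t := by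
  refine ((Complex.ofRealCLM.hasDerivAt (x := t)).const_mul k).cexp.congr_deriv ?_
  simp [mul_comm]

/-- The phase is written as the square of the half-angle exponential occurring in `trajA` and
`trajB`, so that the derivative identities become polynomial. -/
theorem star_trajZ (μ : Covector) (t : ℝ) : star (trajZ μ t) =
    (μ 1 - Complex.I * μ 2) * Complex.exp (-(Complex.I * (μ 0 / 2) * t)) ^ 2 := by
  have e : (μ 0 * t : ℂ) = ((μ 0 * t : ℝ) : ℂ) := by push_cast; ring
  rw [trajZ, star_mul', e, star_exp_I_mul, ← Complex.exp_nat_mul]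
  congr 1
  · simp [sub_eq_add_neg]
  · push_cast
    ring_nf

theorem trajZ_eq (μ : Covector) (t : ℝ) : trajZ μ t =
    (μ 1 + Complex.I * μ 2) * Complex.exp (Complex.I * (μ 0 / 2) * t) ^ 2 := by
  rw [trajZ, ← Complex.exp_nat_mul]
  push_cast
  ring_nf

/-- With `hasDerivAt_trajB`, this is the first row of the matrix equation `q' = q Z`; the second row
follows by conjugation. -/
theorem hasDerivAt_trajA (μ : Covector) (t : ℝ) :
    HasDerivAt (trajA μ) (-(trajB μ t * star (trajZ μ t) / 2)) t := by
  rcases eq_or_ne (halfNorm μ) 0 with h | h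
  · rw [halfNorm_eq_zero h]
    have : trajA 0 = fun _ => 1 := by ext; simp [trajA, halfNorm]
    rw [this]
    exact (hasDerivAt_const t (1 : ℂ)).congr_deriv (by simp [trajZ])
  have hE := hasDerivAt_cexp_mul (-(Complex.I * (μ 0 / 2))) t
  have hA := ((hasDerivAt_ofReal_cos (halfNorm μ) t).fun_add
    ((hasDerivAt_ofReal_sin_div h t).const_mul (Complex.I * (μ 0 / 2)))).fun_mul hE
  have hf : trajA μ = fun s : ℝ => (Real.cos (halfNorm μ * s) +
      Complex.I * (μ 0 / 2) * (Real.sin (halfNorm μ * s) / halfNorm μ)) *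
        Complex.exp (-(Complex.I * (μ 0 / 2)) * s) := by
    ext s
    rw [trajA, neg_mul, mul_assoc Complex.I _ (s : ℂ)]
  rw [hf]
  refine hA.congr_deriv ?_
  rw [star_trajZ, trajB, ← mul_assoc Complex.I _ (t : ℂ), neg_mul]
  have hexp := exp_neg_mul_exp (Complex.I * (μ 0 / 2) * t)
  have h4 : 4 * (halfNorm μ : ℂ) ^ 2 = μ 0 ^ 2 + μ 1 ^ 2 + μ 2 ^ 2 := by
    exact_mod_cast four_mul_halfNorm_sq μ
  have hS : (Real.sin (halfNorm μ * t) : ℂ) =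
      Real.sin (halfNorm μ * t) / halfNorm μ * halfNorm μ := by
    rw [div_mul_cancel₀]; exact_mod_cast h
  generalize (Real.sin (halfNorm μ * t) / halfNorm μ : ℂ) = S at *
  rw [hS]
  generalize Complex.exp (-(Complex.I * (μ 0 / 2) * t)) = E' at *
  generalize Complex.exp (Complex.I * (μ 0 / 2) * t) = E at *
  generalize (Real.cos (halfNorm μ * t) : ℂ) = C at *
  have hI := Complex.I_sq
  generalize Complex.I = I at *
  linear_combination S * E' * (μ 1 ^ 2 - I ^ 2 * μ 2 ^ 2) / 4 * hexp
    - S * E' / 4 * h4 - S * E' / 4 * (μ 0 ^ 2 + μ 2 ^ 2) * hI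

theorem hasDerivAt_trajB (μ : Covector) (t : ℝ) :
    HasDerivAt (trajB μ) (trajA μ t * trajZ μ t / 2) t := by
  rcases eq_or_ne (halfNorm μ) 0 with h | h
  · rw [halfNorm_eq_zero h]
    have : trajB 0 = fun _ => 0 := by ext; simp [trajB]
    rw [this]
    exact (hasDerivAt_const t (0 : ℂ)).congr_deriv (by simp [trajZ])
  have hE := hasDerivAt_cexp_mul (Complex.I * (μ 0 / 2)) t
  have hB := ((hasDerivAt_ofReal_sin_div h t).const_mul
    ((μ 1 + Complex.I * μ 2) / 2)).fun_mul hE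
  have hf : trajB μ = fun s : ℝ => (μ 1 + Complex.I * μ 2) / 2 *
      (Real.sin (halfNorm μ * s) / halfNorm μ) * Complex.exp (Complex.I * (μ 0 / 2) * s) := by
    ext s
    rw [trajB, mul_assoc Complex.I _ (s : ℂ)]
  rw [hf]
  refine hB.congr_deriv ?_
  rw [trajZ_eq, trajA, ← mul_assoc Complex.I _ (t : ℂ)]
  have hexp := exp_neg_mul_exp (Complex.I * (μ 0 / 2) * t)
  generalize (Real.sin (halfNorm μ * t) / halfNorm μ : ℂ) = S at *
  generalize Complex.exp (-(Complex.I * (μ 0 / 2) * t)) = E' at *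
  generalize Complex.exp (Complex.I * (μ 0 / 2) * t) = E at *
  generalize (Real.cos (halfNorm μ * t) : ℂ) = C at *
  linear_combination -E * (μ 1 + Complex.I * μ 2) / 2 *
    (C + Complex.I * (μ 0 / 2) * S) * hexp

/-- The matrix of the extremal trajectory from `1` with covector `μ`. -/
noncomputable def trajMatrix (μ : Covector) (t : ℝ) : Mat2 :=
  !![trajA μ t, trajB μ t; -star (trajB μ t), star (trajA μ t)]

theorem trajMatrix_mem (μ : Covector) (t : ℝ) :
    trajMatrix μ t ∈ Matrix.specialUnitaryGroup (Fin 2) ℂ := by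
  have h := trajA_star_add_trajB_star μ t
  refine Matrix.mem_specialUnitaryGroup_iff.mpr ⟨Matrix.mem_unitaryGroup_iff.mpr ?_, ?_⟩
  · ext i j
    simp only [Complex.star_def] at h
    fin_cases i <;> fin_cases j <;>
      simp [trajMatrix, Matrix.mul_apply, Fin.sum_univ_two, Matrix.star_apply]
    · linear_combination h
    · ring
    · ring
    · linear_combination h
  · rw [trajMatrix, Matrix.det_fin_two_of]
    linear_combination h

/-- The covector of the extremal from `1` with covector `μ`. -/
noncomputable def trajCovector (μ : Covector) (t : ℝ) : Covector :=
  !₂[μ 0, (trajZ μ t).re, (trajZ μ t).im]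

/-- The normal extremal that starts at `(q, μ)`. -/
noncomputable def traj (q : SU2) (μ : Covector) (t : ℝ) : CotBundle :=
  (q * ⟨trajMatrix μ t, trajMatrix_mem μ t⟩, trajCovector μ t)

theorem hasDerivAt_trajMatrix (μ : Covector) (t : ℝ) (i j : Fin 2) :
    HasDerivAt (fun s => trajMatrix μ s i j)
      ((trajMatrix μ t * toMatrix !₂[0, (trajZ μ t).re, (trajZ μ t).im]) i j) t := by
  have hA := hasDerivAt_trajA μ t
  have hB := hasDerivAt_trajB μ t
  have hz : ((trajZ μ t).re : ℂ) + Complex.I * (trajZ μ t).im = trajZ μ t := by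
    rw [mul_comm]; exact Complex.re_add_im _
  have hz' : -((trajZ μ t).re : ℂ) + Complex.I * (trajZ μ t).im = -star (trajZ μ t) := by
    simp [Complex.ext_iff]
  have hZ : toMatrix !₂[0, (trajZ μ t).re, (trajZ μ t).im] =
      !![0, trajZ μ t / 2; -star (trajZ μ t) / 2, 0] := by
    rw [toMatrix_eq]
    rw [← hz']
    simp [hz]
  rw [hZ]
  fin_cases i <;> fin_cases j
  · exact hA.congr_deriv (by simp [trajMatrix, Matrix.mul_apply]; ring)
  · exact hB.congr_deriv (by simp [trajMatrix, Matrix.mul_apply]; ring)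
  · exact hB.star.fun_neg.congr_deriv (by simp [trajMatrix, Matrix.mul_apply]; ring)
  · exact hA.star.congr_deriv (by simp [trajMatrix, Matrix.mul_apply]; ring)

theorem hasDerivAt_trajZ (μ : Covector) (t : ℝ) :
    HasDerivAt (trajZ μ) (Complex.I * μ 0 * trajZ μ t) t := by
  have h : HasDerivAt (fun s : ℝ => Complex.exp (Complex.I * (μ 0 * s)))
      (Complex.exp (Complex.I * (μ 0 * t)) * (Complex.I * (μ 0 * 1))) t :=
    (((Complex.ofRealCLM.hasDerivAt (x := t)).const_mul (μ 0 : ℂ)).const_mul Complex.I).cexp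
  refine (h.const_mul ((μ 1 : ℂ) + Complex.I * μ 2)).congr_deriv ?_
  rw [trajZ]
  ring

theorem isNormalExtremal_traj (q : SU2) (μ : Covector) : IsNormalExtremal (traj q μ) := by
  rw [isNormalExtremal_iff]
  intro t _
  have hz := hasDerivAt_trajZ μ t
  refine ⟨fun i j => ?_, ?_, ?_, ?_⟩
  · have h := fun k => hasDerivAt_trajMatrix μ t k j
    simp only [traj, trajCovector, Submonoid.coe_mul, mul_assoc]
    simp only [Matrix.mul_apply (M := (q : Mat2))]
    exact (HasDerivAt.fun_sum fun k _ => (h k).const_mul _).hasDerivWithinAt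
  · simpa [traj, trajCovector] using hasDerivWithinAt_const _ _ (μ 0)
  · have := (Complex.reCLM.hasFDerivAt.comp_hasDerivAt t hz).hasDerivWithinAt (s := Icc 0 1)
    exact this.congr_deriv (by simp [traj, trajCovector])
  · have := (Complex.imCLM.hasFDerivAt.comp_hasDerivAt t hz).hasDerivWithinAt (s := Icc 0 1)
    exact this.congr_deriv (by simp [traj, trajCovector])

theorem traj_zero (q : SU2) (μ : Covector) : traj q μ 0 = (q, μ) := by
  refine Prod.ext (Subtype.ext ?_) ?_
  · have : trajMatrix μ 0 = 1 := by
      simp [trajMatrix, trajA, trajB, Matrix.one_fin_two]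
    simp [traj, this]
  · ext i
    fin_cases i <;> simp [traj, trajCovector, trajZ]

theorem expDomain_eq_univ (q : SU2) : expDomain q = univ :=
  eq_univ_of_forall fun μ => ⟨traj q μ, isNormalExtremal_traj q μ, traj_zero q μ⟩

/-- Uniqueness identifies the extremal chosen in the definition with the explicit one. -/
theorem srExp_eq (q : SU2) (μ : Covector) :
    srExp q μ = q * ⟨trajMatrix μ 1, trajMatrix_mem μ 1⟩ := by
  have h : μ ∈ expDomain q := expDomain_eq_univ q ▸ mem_univ μ
  rw [srExp, dif_pos h, h.choose_spec.1.unique (isNormalExtremal_traj q μ)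
    (h.choose_spec.2.trans (traj_zero q μ).symm) 1 ⟨zero_le_one, le_rfl⟩]
  rfl

/-! ### The planar map and its double points -/

/-- The first matrix entry of the exponential map as a function of half the vertical component of
the covector and half of its norm. -/
noncomputable def planarMap (p : ℝ × ℝ) : ℂ :=
  (Real.cos p.2 + Complex.I * p.1 * (Real.sin p.2 / p.2)) * Complex.exp (-(Complex.I * p.1))

theorem trajA_one (μ : Covector) : trajA μ 1 = planarMap (μ 0 / 2, halfNorm μ) := by
  simp [trajA, planarMap]

/-- This symmetry produces the double points at the cusps and reduces folds with `x < 0` to those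
with `x > 0`. -/
theorem planarMap_neg (x w : ℝ) : planarMap (-x, w) = star (planarMap (x, w)) := by
  simp only [planarMap, star_mul', star_exp_neg_I_mul]
  congr 1
  · simp only [Complex.star_def, ← Complex.ofReal_div]
    simp [-Complex.ofReal_sin, -Complex.ofReal_cos]
  · push_cast
    ring_nf

/-- A differentiable function whose derivative changes sign is not injective. -/
theorem not_injOn_Icc_of_deriv_neg_pos {f f' : ℝ → ℝ} {l a r : ℝ} (hla : l < a) (har : a < r)
    (hf : ∀ t ∈ Icc l r, HasDerivAt f (f' t) t) (hneg : ∀ t ∈ Ioo l a, f' t < 0)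
    (hpos : ∀ t ∈ Ioo a r, 0 < f' t) : ¬ InjOn f (Icc l r) := by
  intro hinj
  have hcont : ContinuousOn f (Icc l r) := fun t ht => (hf t ht).continuousAt.continuousWithinAt
  have h1 : StrictAntiOn f (Icc l a) := by
    refine strictAntiOn_of_deriv_neg (convex_Icc _ _) (hcont.mono (Icc_subset_Icc_right har.le)) ?_
    intro t ht
    rw [interior_Icc] at ht
    rw [(hf t ⟨ht.1.le, (ht.2.trans har).le⟩).deriv]
    exact hneg t ht
  have h2 : StrictMonoOn f (Icc a r) := by
    refine strictMonoOn_of_deriv_pos (convex_Icc _ _) (hcont.mono (Icc_subset_Icc_left hla.le)) ?_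
    intro t ht
    rw [interior_Icc] at ht
    rw [(hf t ⟨(hla.trans ht.1).le, ht.2.le⟩).deriv]
    exact hpos t ht
  have h1' := h1 ⟨le_rfl, hla.le⟩ ⟨hla.le, le_rfl⟩ hla
  have h2' := h2 ⟨le_rfl, har.le⟩ ⟨har.le, le_rfl⟩ har
  rcases hcont.strictMonoOn_of_injOn_Icc' (hla.trans har).le hinj with h | h
  · exact lt_asymm h1' (h ⟨le_rfl, (hla.trans har).le⟩ ⟨hla.le, har.le⟩ hla)
  · exact lt_asymm h2' (h ⟨hla.le, har.le⟩ ⟨(hla.trans har).le, le_rfl⟩ har)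

theorem hasDerivAt_one_sub_mul_cot {w : ℝ} (hw : Real.sin w ≠ 0) :
    HasDerivAt (fun w => 1 - w * Real.cos w / Real.sin w)
      ((w - Real.sin w * Real.cos w) / Real.sin w ^ 2) w := by
  have h := ((((hasDerivAt_id w).fun_mul (Real.hasDerivAt_cos w)).fun_div
    (Real.hasDerivAt_sin w) hw).const_sub 1)
  refine h.congr_deriv ?_
  simp only [id]
  field_simp
  have := Real.sin_sq_add_cos_sq w
  linear_combination w * this

/-- The derivative has numerator `w - sin w cos w`, positive because `sin (2 w) < 2 w`. Hence `1 - w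
cot w` changes sign at each of its zeros. -/
theorem strictMonoOn_one_sub_mul_cot {l r : ℝ} (hl : 0 < l)
    (hs : ∀ w ∈ Icc l r, Real.sin w ≠ 0) :
    StrictMonoOn (fun w => 1 - w * Real.cos w / Real.sin w) (Icc l r) := by
  refine strictMonoOn_of_deriv_pos (convex_Icc _ _)
    (fun w hw => (hasDerivAt_one_sub_mul_cot (hs w hw)).continuousAt.continuousWithinAt) ?_
  intro w hw
  replace hw := interior_subset hw
  rw [(hasDerivAt_one_sub_mul_cot (hs w hw)).deriv]
  have h2 : Real.sin (2 * w) < 2 * w := Real.sin_lt (by linarith [hw.1])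
  rw [Real.sin_two_mul] at h2
  have := hs w hw
  have : 0 < w - Real.sin w * Real.cos w := by linarith
  positivity

/-- The hypothesis `h` says that `w` times the imaginary part of the value at `(x, w)` vanishes; a
real value is its own conjugate. -/
theorem planarMap_neg_of_real {x w : ℝ} (hw : w ≠ 0)
    (h : x * Real.cos x * Real.sin w = w * Real.cos w * Real.sin x) :
    planarMap (-x, w) = planarMap (x, w) := by
  rw [planarMap_neg, Complex.star_def, Complex.conj_eq_iff_im]
  have hexp : Complex.exp (-(Complex.I * x)) = Real.cos x - Complex.I * Real.sin x := by
    rw [show -(Complex.I * x) = ((-x : ℝ) : ℂ) * Complex.I by push_cast; ring, Complex.exp_mul_I]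
    simp [← Complex.ofReal_sin, ← Complex.ofReal_cos]
    ring
  rw [planarMap, hexp, ← Complex.ofReal_div]
  simp only [Complex.mul_im, Complex.add_re, Complex.add_im, Complex.sub_re, Complex.sub_im,
    Complex.mul_re, Complex.ofReal_re, Complex.ofReal_im, Complex.I_re, Complex.I_im]
  field_simp
  linear_combination h

theorem exists_Icc_of_eventually {P : ℝ → Prop} {a : ℝ} (h : ∀ᶠ w in 𝓝 a, P w) :
    ∃ l r, l < a ∧ a < r ∧ ∀ w ∈ Icc l r, P w := by
  obtain ⟨δ, hδ, h⟩ := Metric.nhds_basis_closedBall.eventually_iff.mp h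
  rw [Real.closedBall_eq_Icc] at h
  exact ⟨a - δ, a + δ, by linarith, by linarith, fun w hw => h hw⟩

/-- The planar map is not injective near its cusps. -/
theorem not_injOn_planarMap_zero {w₀ : ℝ} (hw₀ : 0 < w₀) (hs₀ : Real.sin w₀ ≠ 0)
    (hc : Real.sin w₀ = w₀ * Real.cos w₀) {N : Set (ℝ × ℝ)} (hN : N ∈ 𝓝 ((0 : ℝ), w₀)) :
    ¬ InjOn planarMap N := by
  intro hinj
  have hN' : ∀ᶠ p : ℝ × ℝ in 𝓝 (0 : ℝ) ×ˢ 𝓝 w₀, p ∈ N ∧ (-p.1, p.2) ∈ N := by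
    rw [← nhds_prod_eq]
    refine Filter.Eventually.and hN ?_
    have : Continuous fun p : ℝ × ℝ => (-p.1, p.2) := by fun_prop
    exact this.continuousAt.eventually_mem (by simpa using hN)
  obtain ⟨P, hP, Q, hQ, hPQ⟩ := Filter.eventually_prod_iff.mp hN'
  have hsc : ∀ᶠ w in 𝓝 w₀, Q w ∧ 0 < w ∧ Real.sin w ≠ 0 :=
    hQ.and ((lt_mem_nhds hw₀).and (Real.continuous_sin.continuousAt.eventually_ne hs₀))
  obtain ⟨l, r, hl, hr, hlr⟩ := exists_Icc_of_eventually hsc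
  have hmono := strictMonoOn_one_sub_mul_cot (hlr l ⟨le_rfl, (hl.trans hr).le⟩).2.1
    (fun w hw => (hlr w hw).2.2)
  have hzero : 1 - w₀ * Real.cos w₀ / Real.sin w₀ = 0 := by
    rw [← hc, div_self hs₀, sub_self]
  have hlneg := hmono ⟨le_rfl, (hl.trans hr).le⟩ ⟨hl.le, hr.le⟩ hl
  have hrpos := hmono ⟨hl.le, hr.le⟩ ⟨(hl.trans hr).le, le_rfl⟩ hr
  simp only [hzero] at hlneg hrpos
  -- Divided by `x sin w`, the reality condition reads `cos x = w cot w * sinc x`, which extends to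
  -- `x = 0`. There the difference of the two sides is `1 - w cot w`, of opposite signs at `l` and
  -- `r`; the signs persist for small `x`.
  have hcont : ∀ k : ℝ, Continuous fun x => Real.cos x - k * Real.sinc x := fun k =>
    Real.continuous_cos.sub (Real.continuous_sinc.const_mul k)
  have el : ∀ᶠ x in 𝓝 (0 : ℝ),
      Real.cos x - l * Real.cos l / Real.sin l * Real.sinc x < 0 :=
    (hcont _).continuousAt.eventually_lt_const (by simpa using hlneg)
  have er : ∀ᶠ x in 𝓝 (0 : ℝ),
      0 < Real.cos x - r * Real.cos r / Real.sin r * Real.sinc x :=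
    (hcont _).continuousAt.eventually_const_lt (by simpa using hrpos)
  -- Taking `x > 0` keeps `(x, w)` and `(-x, w)` distinct.
  obtain ⟨x, ⟨hxP, hxl, hxr⟩, hx⟩ :=
    (((hP.and (el.and er)).filter_mono nhdsWithin_le_nhds).and
      (self_mem_nhdsWithin (s := Ioi (0 : ℝ)))).exists
  have hx : 0 < x := hx
  obtain ⟨w, hw, hroot⟩ : (0 : ℝ) ∈
      (fun w => Real.cos x - w * Real.cos w / Real.sin w * Real.sinc x) '' Icc l r := by
    refine intermediate_value_Icc (hl.trans hr).le ?_ ⟨hxl.le, hxr.le⟩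
    refine continuousOn_const.sub (ContinuousOn.mul (ContinuousOn.div ?_ ?_ ?_) continuousOn_const)
    · fun_prop
    · fun_prop
    · exact fun w hw => (hlr w hw).2.2
  obtain ⟨hQw, hw0, hsw⟩ := hlr w hw
  have heq : planarMap (-x, w) = planarMap (x, w) := by
    refine planarMap_neg_of_real hw0.ne' ?_
    simp only [Real.sinc_of_ne_zero hx.ne'] at hroot
    field_simp at hroot
    linarith
  have := hinj (hPQ hxP hQw).2 (hPQ hxP hQw).1 heq
  have := congrArg Prod.fst this
  simp only at this
  linarith

/-- A polar form whose radius carries the sign of `cos w`, so that the argument is a smooth `arctan`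
with no branch to choose. -/
theorem cos_add_I_mul_mul_tan {s w : ℝ} (hc : Real.cos w ≠ 0) :
    (Real.cos w + Complex.I * s * Real.sin w : ℂ) =
      (Real.cos w * √(1 + (s * Real.tan w) ^ 2) : ℝ) *
        Complex.exp (Complex.I * Real.arctan (s * Real.tan w)) := by
  have hpos : 0 < √(1 + (s * Real.tan w) ^ 2) := by positivity
  rw [mul_comm Complex.I (Real.arctan _ : ℂ), Complex.exp_mul_I, ← Complex.ofReal_cos,
    ← Complex.ofReal_sin, Real.cos_arctan, Real.sin_arctan]
  apply Complex.ext
  · simp [-Complex.ofReal_cos, -Complex.ofReal_sin, -Complex.ofReal_tan]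
    field_simp
  · simp [-Complex.ofReal_cos, -Complex.ofReal_sin, -Complex.ofReal_tan]
    rw [Real.tan_eq_sin_div_cos]
    field_simp

/-- With `s = x / w` the squared modulus is `1 - (1 - s²) sin² w`. So `hnorm` equates the squared
radii, `hc` their signs, and `harg` the phases. -/
theorem planarMap_eq_of_arg_eq {s₁ w₁ s₂ w₂ : ℝ} (h₁ : 0 < w₁) (h₂ : 0 < w₂)
    (hc : 0 < Real.cos w₁ * Real.cos w₂)
    (hnorm : (1 - s₁ ^ 2) * Real.sin w₁ ^ 2 = (1 - s₂ ^ 2) * Real.sin w₂ ^ 2)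
    (harg : Real.arctan (s₁ * Real.tan w₁) - s₁ * w₁ =
      Real.arctan (s₂ * Real.tan w₂) - s₂ * w₂) :
    planarMap (s₁ * w₁, w₁) = planarMap (s₂ * w₂, w₂) := by
  have hc₁ : Real.cos w₁ ≠ 0 := left_ne_zero_of_mul hc.ne'
  have hc₂ : Real.cos w₂ ≠ 0 := right_ne_zero_of_mul hc.ne'
  have hform : ∀ s w : ℝ, 0 < w → Real.cos w ≠ 0 → planarMap (s * w, w) =
      (Real.cos w * √(1 + (s * Real.tan w) ^ 2) : ℝ) *
        Complex.exp (Complex.I * (Real.arctan (s * Real.tan w) - s * w : ℝ)) := by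
    intro s w hw hc
    have hw' : (w : ℂ) ≠ 0 := by exact_mod_cast hw.ne'
    have : (Real.cos w + Complex.I * (s * w : ℝ) * (Real.sin w / w) : ℂ) =
        Real.cos w + Complex.I * s * Real.sin w := by
      push_cast
      field_simp
    simp only [planarMap]
    rw [this, cos_add_I_mul_mul_tan hc, mul_assoc, ← Complex.exp_add]
    push_cast
    ring_nf
  rw [hform _ _ h₁ hc₁, hform _ _ h₂ hc₂, harg]
  congr 2
  have hsq : ∀ s w : ℝ, Real.cos w ≠ 0 → (Real.cos w * √(1 + (s * Real.tan w) ^ 2)) ^ 2 =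
      1 - (1 - s ^ 2) * Real.sin w ^ 2 := by
    intro s w hc
    rw [mul_pow, Real.sq_sqrt (by positivity), Real.tan_eq_sin_div_cos]
    field_simp
    linear_combination Real.sin_sq_add_cos_sq w
  have hp₁ : 0 < √(1 + (s₁ * Real.tan w₁) ^ 2) := by positivity
  have hp₂ : 0 < √(1 + (s₂ * Real.tan w₂) ^ 2) := by positivity
  have h := (hsq s₁ w₁ hc₁).trans (hnorm ▸ (hsq s₂ w₂ hc₂).symm)
  rcases sq_eq_sq_iff_eq_or_eq_neg.mp h with h | h
  · exact h
  · exfalso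
    have : 0 < (Real.cos w₁ * Real.cos w₂) *
        (√(1 + (s₁ * Real.tan w₁) ^ 2) * √(1 + (s₂ * Real.tan w₂) ^ 2)) := by positivity
    nlinarith [sq_nonneg (Real.cos w₂ * √(1 + (s₂ * Real.tan w₂) ^ 2))]

/-- The derivative of the argument of the planar map along a level curve of its modulus. -/
theorem hasDerivAt_arg_levelCurve {c w : ℝ} (hs : Real.sin w ≠ 0) (hcos : Real.cos w ≠ 0)
    (hc : c < Real.sin w ^ 2) :
    HasDerivAt (fun w => Real.arctan (√(1 - c / Real.sin w ^ 2) * Real.tan w) -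
        √(1 - c / Real.sin w ^ 2) * w)
      (c / Real.sin w ^ 2 / √(1 - c / Real.sin w ^ 2) * (1 - w * Real.cos w / Real.sin w)) w := by
  have hpos : 0 < 1 - c / Real.sin w ^ 2 := by
    rw [sub_pos, div_lt_one (by positivity)]
    exact hc
  have hsqrt : HasDerivAt (fun w => √(1 - c / Real.sin w ^ 2))
      (c / Real.sin w ^ 2 * Real.cos w / (√(1 - c / Real.sin w ^ 2) * Real.sin w)) w := by
    have h1 := ((((hasDerivAt_const w c).fun_div ((Real.hasDerivAt_sin w).fun_pow 2)
      (pow_ne_zero 2 hs)).const_sub 1).sqrt hpos.ne')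
    refine h1.congr_deriv ?_
    have := (Real.sqrt_pos.mpr hpos).ne'
    generalize √(1 - c / Real.sin w ^ 2) = s at *
    field_simp
    simp
    ring
  refine ((hsqrt.fun_mul (Real.hasDerivAt_tan hcos)).arctan.fun_sub
    (hsqrt.fun_mul (hasDerivAt_id w))).congr_deriv ?_
  have hs0 := (Real.sqrt_pos.mpr hpos).ne'
  have hs2 := Real.sq_sqrt hpos.le
  -- Eliminating `c` leaves a rational identity in `s`, `sin w` and `cos w`.
  have hk : c / Real.sin w ^ 2 = 1 - √(1 - c / Real.sin w ^ 2) ^ 2 := by rw [hs2]; ring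
  generalize √(1 - c / Real.sin w ^ 2) = s at *
  rw [hk, Real.tan_eq_sin_div_cos]
  have hcs := Real.cos_sq_add_sin_sq w
  have hD : Real.cos w ^ 2 + s ^ 2 * Real.sin w ^ 2 ≠ 0 := by positivity
  have hD' : 1 + (s * (Real.sin w / Real.cos w)) ^ 2 =
      (Real.cos w ^ 2 + s ^ 2 * Real.sin w ^ 2) / Real.cos w ^ 2 := by
    field_simp
  rw [hD']
  simp only [id]
  field_simp
  linear_combination -(s ^ 2 * Real.sin w) * hcs

/-- The planar map is not injective near its folds. -/
theorem not_injOn_planarMap_pos {x₀ w₀ : ℝ} (hx₀ : 0 < x₀) (hxw : x₀ < w₀)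
    (hs₀ : Real.sin w₀ ≠ 0) (hc : Real.sin w₀ = w₀ * Real.cos w₀) {N : Set (ℝ × ℝ)}
    (hN : N ∈ 𝓝 (x₀, w₀)) : ¬ InjOn planarMap N := by
  intro hinj
  have hw₀ : 0 < w₀ := hx₀.trans hxw
  have hcos₀ : Real.cos w₀ ≠ 0 := fun h => hs₀ (by rw [hc, h, mul_zero])
  -- The value of `1 - |A|²` at `(x₀, w₀)`. The level curve of `|A|` through this point is
  -- parametrised by `w`, with `s w` the ratio `x / w`.
  obtain ⟨c, hcdef⟩ : ∃ c, c = (1 - (x₀ / w₀) ^ 2) * Real.sin w₀ ^ 2 := ⟨_, rfl⟩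
  have hr1 : x₀ / w₀ < 1 := (div_lt_one hw₀).mpr hxw
  have hr0 : 0 < x₀ / w₀ := by positivity
  have hs2 : 0 < Real.sin w₀ ^ 2 := by positivity
  have hcpos : 0 < c := by
    rw [hcdef]
    have : 0 < 1 - (x₀ / w₀) ^ 2 := by nlinarith
    positivity
  have hclt : c < Real.sin w₀ ^ 2 := by
    rw [hcdef]
    nlinarith [pow_pos hr0 2]
  obtain ⟨s, hs⟩ : ∃ s : ℝ → ℝ, s = fun w => √(1 - c / Real.sin w ^ 2) := ⟨_, rfl⟩
  have hss₀ : s w₀ = x₀ / w₀ := by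
    rw [hs, hcdef]
    simp only
    rw [mul_div_cancel_right₀ _ hs2.ne', sub_sub_cancel, Real.sqrt_sq hr0.le]
  have hγ : ContinuousAt (fun w => (s w * w, w)) w₀ := by
    rw [hs]
    refine ContinuousAt.prodMk (ContinuousAt.mul (ContinuousAt.sqrt ?_) continuousAt_id)
      continuousAt_id
    exact continuousAt_const.sub (continuousAt_const.div
      (Real.continuous_sin.continuousAt.pow 2) hs2.ne')
  have hγN : ∀ᶠ w in 𝓝 w₀, (s w * w, w) ∈ N := by
    refine hγ.eventually_mem ?_
    rwa [hss₀, div_mul_cancel₀ _ hw₀.ne']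
  have hcc : ∀ᶠ w in 𝓝 w₀, 0 < Real.cos w * Real.cos w₀ := by
    refine (Real.continuous_cos.mul continuous_const).continuousAt.eventually_const_lt ?_
    exact mul_self_pos.mpr hcos₀
  have hsc : ∀ᶠ w in 𝓝 w₀, c < Real.sin w ^ 2 :=
    (Real.continuous_sin.pow 2).continuousAt.eventually_const_lt hclt
  obtain ⟨l, r, hl, hr, hlr⟩ := exists_Icc_of_eventually
    (hγN.and (hcc.and (hsc.and (lt_mem_nhds hw₀))))
  have hsin : ∀ w ∈ Icc l r, Real.sin w ≠ 0 := fun w hw h => by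
    have := (hlr w hw).2.2.1
    rw [h] at this
    nlinarith
  have hcos : ∀ w ∈ Icc l r, Real.cos w ≠ 0 := fun w hw =>
    left_ne_zero_of_mul (hlr w hw).2.1.ne'
  have hmono := strictMonoOn_one_sub_mul_cot (hlr l ⟨le_rfl, (hl.trans hr).le⟩).2.2.2 hsin
  have hzero : 1 - w₀ * Real.cos w₀ / Real.sin w₀ = 0 := by
    rw [← hc, div_self hs₀, sub_self]
  have hsqrt : ∀ w ∈ Icc l r, 0 < 1 - c / Real.sin w ^ 2 := fun w hw => by
    have := hsin w hw
    rw [sub_pos, div_lt_one (by positivity)]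
    exact (hlr w hw).2.2.1
  have hfac : ∀ w ∈ Icc l r, 0 < c / Real.sin w ^ 2 / √(1 - c / Real.sin w ^ 2) :=
    fun w hw => by
      have := hsin w hw
      have := Real.sqrt_pos.mpr (hsqrt w hw)
      positivity
  refine not_injOn_Icc_of_deriv_neg_pos hl hr
    (fun w hw => hasDerivAt_arg_levelCurve (hsin w hw) (hcos w hw) (hlr w hw).2.2.1) ?_ ?_ ?_
  · intro w hw
    have hw' : w ∈ Icc l r := ⟨hw.1.le, (hw.2.trans hr).le⟩
    have := hmono hw' ⟨hl.le, hr.le⟩ hw.2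
    simp only [hzero] at this
    exact mul_neg_of_pos_of_neg (hfac w hw') this
  · intro w hw
    have hw' : w ∈ Icc l r := ⟨(hl.trans hw.1).le, hw.2.le⟩
    have := hmono ⟨hl.le, hr.le⟩ hw' hw.1
    simp only [hzero] at this
    exact mul_pos (hfac w hw') this
  · intro w₁ h₁ w₂ h₂ harg
    have hn : ∀ w ∈ Icc l r, (1 - s w ^ 2) * Real.sin w ^ 2 = c := fun w hw => by
      have := hsin w hw
      rw [hs]
      simp only
      rw [Real.sq_sqrt (hsqrt w hw).le]
      field_simp
      ring
    have hc12 : 0 < Real.cos w₁ * Real.cos w₂ := by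
      have h3 := mul_pos (hlr w₁ h₁).2.1 (hlr w₂ h₂).2.1
      have h4 : 0 < Real.cos w₀ ^ 2 := by positivity
      by_contra! hle
      nlinarith
    have := hinj (hlr w₁ h₁).1 (hlr w₂ h₂).1 (planarMap_eq_of_arg_eq (hlr w₁ h₁).2.2.2
      (hlr w₂ h₂).2.2.2 hc12 ((hn w₁ h₁).trans (hn w₂ h₂).symm) (by rw [hs]; exact harg))
    exact congrArg Prod.snd this

/-- The planar map is not injective near its critical points off the lines `sin w = 0`. -/
theorem not_injOn_planarMap {x₀ w₀ : ℝ} (hxw : |x₀| < w₀) (hs₀ : Real.sin w₀ ≠ 0)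
    (hc : Real.sin w₀ = w₀ * Real.cos w₀) {N : Set (ℝ × ℝ)} (hN : N ∈ 𝓝 (x₀, w₀)) :
    ¬ InjOn planarMap N := by
  rcases lt_trichotomy x₀ 0 with hx | rfl | hx
  · rw [abs_of_neg hx] at hxw
    intro hinj
    have hcont : Continuous fun p : ℝ × ℝ => (-p.1, p.2) := by fun_prop
    -- Reflection in `x` moves the problem to a fold with positive first coordinate.
    have hN' : (fun p : ℝ × ℝ => (-p.1, p.2)) ⁻¹' N ∈ 𝓝 (-x₀, w₀) :=
      hcont.continuousAt.preimage_mem_nhds (by simpa using hN)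
    refine not_injOn_planarMap_pos (neg_pos.mpr hx) hxw hs₀ hc hN' ?_
    rintro ⟨x, w⟩ hp ⟨x', w'⟩ hp' h
    have := hinj hp hp' (by simp only [planarMap_neg, h])
    simpa using this
  · exact not_injOn_planarMap_zero (by simpa using hxw) hs₀ hc hN
  · exact not_injOn_planarMap_pos hx ((le_abs_self _).trans_lt hxw) hs₀ hc hN

/-! ### From the planar map to the exponential map -/

/-- The covector with vertical component `h` and horizontal part `z`. -/
noncomputable def ofVertHoriz (h : ℝ) (z : ℂ) : Covector := !₂[h, z.re, z.im]

theorem ofVertHoriz_self (μ : Covector) :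
    ofVertHoriz (μ 0) (μ 1 + Complex.I * μ 2) = μ := by
  ext i
  fin_cases i <;> simp [ofVertHoriz]

theorem continuous_ofVertHoriz : Continuous fun p : ℝ × ℂ => ofVertHoriz p.1 p.2 := by
  unfold ofVertHoriz
  refine (PiLp.continuous_toLp 2 _).comp (continuous_pi fun i => ?_)
  fin_cases i
  · exact continuous_fst
  · exact Complex.continuous_re.comp continuous_snd
  · exact Complex.continuous_im.comp continuous_snd

theorem ofVertHoriz_injective {h h' : ℝ} {z z' : ℂ}
    (e : ofVertHoriz h z = ofVertHoriz h' z') : h = h' ∧ z = z' := by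
  have e0 := congrArg (fun μ : Covector => μ 0) e
  have e1 := congrArg (fun μ : Covector => μ 1) e
  have e2 := congrArg (fun μ : Covector => μ 2) e
  simp [ofVertHoriz] at e0 e1 e2
  exact ⟨e0, Complex.ext e1 e2⟩

theorem halfNorm_ofVertHoriz (h : ℝ) (z : ℂ) :
    halfNorm (ofVertHoriz h z) = √(h ^ 2 + ‖z‖ ^ 2) / 2 := by
  simp [halfNorm, ofVertHoriz, Complex.sq_norm, Complex.normSq_apply]
  ring_nf

theorem trajA_ofVertHoriz (h : ℝ) (z : ℂ) :
    trajA (ofVertHoriz h z) 1 = planarMap (h / 2, √(h ^ 2 + ‖z‖ ^ 2) / 2) := by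
  rw [trajA_one, halfNorm_ofVertHoriz]
  simp [ofVertHoriz]

theorem trajB_ofVertHoriz (h : ℝ) (z : ℂ) :
    trajB (ofVertHoriz h z) 1 = z / 2 *
      ((Real.sin (√(h ^ 2 + ‖z‖ ^ 2) / 2) / (√(h ^ 2 + ‖z‖ ^ 2) / 2) : ℝ) : ℂ) *
      Complex.exp (Complex.I * (h / 2)) := by
  have hz : (z.re + Complex.I * z.im : ℂ) = z := by rw [mul_comm]; exact Complex.re_add_im z
  rw [trajB, halfNorm_ofVertHoriz]
  simp [ofVertHoriz, hz]

theorem srExp_eq_srExp (q : SU2) {μ ν : Covector} (hA : trajA μ 1 = trajA ν 1)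
    (hB : trajB μ 1 = trajB ν 1) : srExp q μ = srExp q ν := by
  rw [srExp_eq, srExp_eq]
  congr 2
  rw [trajMatrix, trajMatrix, hA, hB]

/-- For a vertical covector `w = |x|`, and the bracket in `planarMap` becomes `e^{ix}`, cancelling
the phase. -/
theorem planarMap_abs (x : ℝ) : planarMap (x, |x|) = 1 := by
  have key : ∀ x : ℝ, (Real.cos x + Complex.I * Real.sin x : ℂ) *
      Complex.exp (-(Complex.I * x)) = 1 := fun x => by
    have : (Real.cos x + Complex.I * Real.sin x : ℂ) = Complex.exp (Complex.I * x) := by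
      rw [mul_comm Complex.I (x : ℂ), Complex.exp_mul_I]
      push_cast
      ring
    rw [this, mul_comm, exp_neg_mul_exp]
  rcases eq_or_ne x 0 with rfl | hx
  · simp [planarMap]
  rw [← key x]
  have hx' : (x : ℂ) ≠ 0 := by exact_mod_cast hx
  rcases abs_cases x with ⟨h, -⟩ | ⟨h, -⟩ <;> simp only [planarMap, h, Real.cos_neg, Real.sin_neg]
    <;> congr 2 <;> push_cast <;> field_simp

/-- The exponential map is constant on vertical covectors. -/
theorem not_injOn_srExp_vertical (q : SU2) (h : ℝ) {U : Set Covector}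
    (hU : U ∈ 𝓝 (ofVertHoriz h 0)) : ¬ InjOn (srExp q) U := by
  intro hinj
  have hcont : Continuous fun k : ℝ => ofVertHoriz k 0 :=
    continuous_ofVertHoriz.comp (Continuous.prodMk_left 0)
  have hev : ∀ᶠ k in 𝓝[≠] h, ofVertHoriz k 0 ∈ U :=
    (hcont.continuousAt.eventually_mem hU).filter_mono nhdsWithin_le_nhds
  obtain ⟨k, hk, hne⟩ := (hev.and (self_mem_nhdsWithin (s := {h}ᶜ))).exists
  have hA : ∀ k : ℝ, trajA (ofVertHoriz k 0) 1 = 1 := fun k => by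
    rw [trajA_ofVertHoriz, norm_zero, zero_pow two_ne_zero, add_zero, Real.sqrt_sq_eq_abs,
      ← planarMap_abs (k / 2), abs_div, abs_two]
  have hB : ∀ k : ℝ, trajB (ofVertHoriz k 0) 1 = 0 := fun k => by
    rw [trajB_ofVertHoriz]
    simp
  have := hinj hk (mem_of_mem_nhds hU)
    (srExp_eq_srExp q ((hA k).trans (hA h).symm) ((hB k).trans (hB h).symm))
  exact hne (ofVertHoriz_injective this).1

/-- The exponential map is constant on the circles of covectors of norm in `2 π ℤ`. -/
theorem not_injOn_srExp_of_sin_eq_zero (q : SU2) {h : ℝ} {z : ℂ} (hz : z ≠ 0)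
    (hs : Real.sin (√(h ^ 2 + ‖z‖ ^ 2) / 2) = 0) {U : Set Covector}
    (hU : U ∈ 𝓝 (ofVertHoriz h z)) : ¬ InjOn (srExp q) U := by
  intro hinj
  have hcont : Continuous fun φ : ℝ => ofVertHoriz h (z * Complex.exp (Complex.I * φ)) :=
    continuous_ofVertHoriz.comp (by fun_prop : Continuous fun φ : ℝ =>
      (h, z * Complex.exp (Complex.I * φ)))
  -- Rotating `z` preserves `A`, while `B` vanishes with `sin w`. For `φ` in `(0, π)` the positive
  -- sine distinguishes `e^{iφ}` from `1`.
  have hev : ∀ᶠ φ : ℝ in 𝓝[>] (0 : ℝ), ofVertHoriz h (z * Complex.exp (Complex.I * φ)) ∈ U :=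
    (hcont.continuousAt.eventually_mem (by simpa using hU)).filter_mono nhdsWithin_le_nhds
  obtain ⟨φ, hφU, hφ⟩ := (hev.and (Ioo_mem_nhdsGT Real.pi_pos)).exists
  have hn : ‖z * Complex.exp (Complex.I * φ)‖ = ‖z‖ := by
    rw [norm_mul, mul_comm Complex.I, Complex.norm_exp_ofReal_mul_I, mul_one]
  have := hinj hφU (mem_of_mem_nhds hU) (srExp_eq_srExp q
    (by rw [trajA_ofVertHoriz, trajA_ofVertHoriz, hn])
    (by rw [trajB_ofVertHoriz, trajB_ofVertHoriz, hn, hs]; simp))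
  have h1 := mul_left_cancel₀ hz ((ofVertHoriz_injective this).2.trans (mul_one z).symm)
  rw [mul_comm Complex.I, Complex.exp_mul_I] at h1
  have h2 := congrArg Complex.im h1
  simp [← Complex.ofReal_sin, ← Complex.ofReal_cos] at h2
  exact (Real.sin_pos_of_pos_of_lt_pi hφ.1 hφ.2).ne' h2

theorem norm_sq_planarMap (x w : ℝ) :
    ‖planarMap (x, w)‖ ^ 2 = Real.cos w ^ 2 + (x * (Real.sin w / w)) ^ 2 := by
  have : ‖Complex.exp (-(Complex.I * x))‖ = 1 := by
    rw [show -(Complex.I * x) = ((-x : ℝ) : ℂ) * Complex.I by push_cast; ring,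
      Complex.norm_exp_ofReal_mul_I]
  simp only [planarMap]
  rw [norm_mul, this, mul_one, Complex.sq_norm, Complex.normSq_apply, ← Complex.ofReal_div]
  simp [-Complex.ofReal_cos, -Complex.ofReal_sin, -Complex.ofReal_div]
  ring

/-- Noninjectivity of the planar map lifts to the exponential map. -/
theorem not_injOn_srExp_of_planarMap (q : SU2) {x₀ w₀ : ℝ} {u : ℂ} (hu : ‖u‖ = 1)
    (hxw : |x₀| < w₀) (hs₀ : Real.sin w₀ ≠ 0)
    (hplanar : ∀ N ∈ 𝓝 (x₀, w₀), ¬ InjOn planarMap N) {U : Set Covector}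
    (hU : U ∈ 𝓝 (ofVertHoriz (2 * x₀) ((2 * √(w₀ ^ 2 - x₀ ^ 2) : ℝ) * u))) :
    ¬ InjOn (srExp q) U := by
  intro hinj
  -- The modulus `2 √(w² - x²)` makes `w` half the norm of the covector, and the phase `e^{i(x₀ -
  -- x)}` compensates the factor `e^{ix}` of `B`, leaving the constant phase `u e^{i x₀}`.
  obtain ⟨L, hL⟩ : ∃ L : ℝ × ℝ → Covector, L = fun p => ofVertHoriz (2 * p.1)
      ((2 * √(p.2 ^ 2 - p.1 ^ 2) : ℝ) *
        (u * Complex.exp (Complex.I * ((x₀ - p.1 : ℝ) : ℂ)))) := ⟨_, rfl⟩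
  have hcont : Continuous L := by
    rw [hL]
    exact continuous_ofVertHoriz.comp (by fun_prop : Continuous fun p : ℝ × ℝ =>
      (2 * p.1, ((2 * √(p.2 ^ 2 - p.1 ^ 2) : ℝ) *
        (u * Complex.exp (Complex.I * ((x₀ - p.1 : ℝ) : ℂ))) : ℂ)))
  have e1 : ∀ᶠ p in 𝓝 (x₀, w₀), L p ∈ U :=
    hcont.continuousAt.eventually_mem (by simpa [hL] using hU)
  have e2 : ∀ᶠ p : ℝ × ℝ in 𝓝 (x₀, w₀), |p.1| < p.2 :=
    (continuous_fst.abs.continuousAt).eventually_lt continuous_snd.continuousAt hxw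
  -- The real coefficient of `B` has square `1 - |A|²`; a constant sign of `sin w` makes it a
  -- function of `A`.
  have e3 : ∀ᶠ p : ℝ × ℝ in 𝓝 (x₀, w₀), 0 < Real.sin p.2 * Real.sin w₀ :=
    ((Real.continuous_sin.comp continuous_snd).mul continuous_const).continuousAt
      |>.eventually_const_lt (mul_self_pos.mpr hs₀)
  refine hplanar _ (e1.and (e2.and e3)) ?_
  rintro ⟨x, w⟩ ⟨hpU, hp, hps⟩ ⟨x', w'⟩ ⟨hpU', hp', hps'⟩ heq
  simp only at hp hps hp' hps'
  have hw : ∀ {x w : ℝ}, |x| < w → 0 < w ∧ 0 < w ^ 2 - x ^ 2 := fun {x w} h =>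
    ⟨(abs_nonneg x).trans_lt h, sub_pos.mpr (sq_lt_sq.mpr (h.trans_le (le_abs_self w)))⟩
  have hnorm : ∀ {x w : ℝ}, |x| < w → √((2 * x) ^ 2 + ‖((2 * √(w ^ 2 - x ^ 2) : ℝ) : ℂ) *
      (u * Complex.exp (Complex.I * ((x₀ - x : ℝ) : ℂ)))‖ ^ 2) / 2 = w := fun {x w} h => by
    rw [norm_mul, norm_mul, hu, mul_comm Complex.I, Complex.norm_exp_ofReal_mul_I, mul_one,
      mul_one, Complex.norm_real, Real.norm_eq_abs, sq_abs, mul_pow, mul_pow,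
      Real.sq_sqrt (hw h).2.le, show 2 ^ 2 * x ^ 2 + 2 ^ 2 * (w ^ 2 - x ^ 2) = (2 * w) ^ 2 by ring,
      Real.sqrt_sq (by linarith [(hw h).1])]
    ring
  have hA : ∀ {x w : ℝ}, |x| < w → trajA (L (x, w)) 1 = planarMap (x, w) := fun {x w} h => by
    simp only [hL]
    rw [trajA_ofVertHoriz, hnorm h, mul_div_cancel_left₀ _ two_ne_zero]
  have hB : ∀ {x w : ℝ}, |x| < w → trajB (L (x, w)) 1 =
      ((√(w ^ 2 - x ^ 2) * (Real.sin w / w) : ℝ) : ℂ) * (u * Complex.exp (Complex.I * x₀)) :=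
    fun {x w} h => by
      simp only [hL]
      rw [trajB_ofVertHoriz, hnorm h]
      have : Complex.exp (Complex.I * x₀) = Complex.exp (Complex.I * ((x₀ - x : ℝ) : ℂ)) *
          Complex.exp (Complex.I * (((2 * x : ℝ) : ℂ) / 2)) := by
        rw [← Complex.exp_add]
        push_cast
        ring_nf
      rw [this]
      push_cast
      ring
  have hsq : ∀ {x w : ℝ}, |x| < w → (√(w ^ 2 - x ^ 2) * (Real.sin w / w)) ^ 2 =
      1 - ‖planarMap (x, w)‖ ^ 2 := fun {x w} h => by
    rw [norm_sq_planarMap, mul_pow, Real.sq_sqrt (hw h).2.le]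
    have := (hw h).1.ne'
    field_simp
    linear_combination w ^ 2 * Real.sin_sq_add_cos_sq w
  have hsgn : ∀ {x w : ℝ}, |x| < w → 0 < Real.sin w * Real.sin w₀ →
      0 < √(w ^ 2 - x ^ 2) * (Real.sin w / w) * Real.sin w₀ := fun {x w} h hs => by
    have h1 := Real.sqrt_pos.mpr (hw h).2
    have h2 := (hw h).1
    have : √(w ^ 2 - x ^ 2) * (Real.sin w / w) * Real.sin w₀ =
        √(w ^ 2 - x ^ 2) / w * (Real.sin w * Real.sin w₀) := by ring
    rw [this]
    positivity
  have hT : √(w ^ 2 - x ^ 2) * (Real.sin w / w) = √(w' ^ 2 - x' ^ 2) * (Real.sin w' / w') := by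
    have h := (hsq hp).trans (heq ▸ (hsq hp').symm)
    rcases sq_eq_sq_iff_eq_or_eq_neg.mp h with h | h
    · exact h
    · have h1 := hsgn hp hps
      have h2 := hsgn hp' hps'
      rw [h] at h1
      linarith
  have hLL := hinj hpU hpU' (srExp_eq_srExp q (by rw [hA hp, hA hp', heq])
    (by rw [hB hp, hB hp', hT]))
  have hww : w = w' := by
    have := congrArg halfNorm hLL
    simp only [hL, halfNorm_ofVertHoriz] at this
    rwa [hnorm hp, hnorm hp'] at this
  simp only [hL] at hLL
  have := (ofVertHoriz_injective hLL).1
  exact Prod.ext (by linarith) hww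

/-! ### The differential and the conjugate covectors -/

theorem differentiableAt_coord (i : Fin 3) (μ : Covector) :
    DifferentiableAt ℝ (fun ν : Covector => ν i) μ :=
  (EuclideanSpace.proj i : Covector →L[ℝ] ℝ).differentiableAt

/-- Excluding the origin costs nothing: the zero covector is vertical and is treated without
derivatives. -/
theorem differentiableAt_halfNorm {μ : Covector} (h : halfNorm μ ≠ 0) :
    DifferentiableAt ℝ halfNorm μ := by
  have h4 := four_mul_halfNorm_sq μ
  have hd := differentiableAt_coord
  unfold halfNorm
  simp only [div_eq_mul_inv]
  refine DifferentiableAt.mul_const (DifferentiableAt.sqrt ?_ ?_) 2⁻¹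
  · exact (((hd 0 μ).fun_pow 2).fun_add ((hd 1 μ).fun_pow 2)).fun_add ((hd 2 μ).fun_pow 2)
  · rw [← h4]
    positivity

theorem differentiableAt_ofReal_comp {f : Covector → ℝ} {μ : Covector}
    (hf : DifferentiableAt ℝ f μ) : DifferentiableAt ℝ (fun ν => (f ν : ℂ)) μ :=
  Complex.ofRealCLM.differentiableAt.comp μ hf

theorem differentiableAt_sin_div_halfNorm {μ : Covector} (h : halfNorm μ ≠ 0) :
    DifferentiableAt ℝ (fun ν => (Real.sin (halfNorm ν * (1 : ℝ)) / halfNorm ν : ℂ)) μ := by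
  have hn := differentiableAt_halfNorm h
  have := differentiableAt_ofReal_comp (((hn.mul_const 1).sin).fun_mul (hn.fun_inv h))
  simpa only [Complex.ofReal_div, div_eq_mul_inv, Complex.ofReal_mul, Complex.ofReal_inv] using this

theorem differentiableAt_trajA {μ : Covector} (h : halfNorm μ ≠ 0) :
    DifferentiableAt ℝ (fun ν => trajA ν 1) μ := by
  have hn := differentiableAt_halfNorm h
  have hc := differentiableAt_ofReal_comp ((hn.mul_const 1).cos)
  have h0 := differentiableAt_ofReal_comp (differentiableAt_coord 0 μ)
  have hs := differentiableAt_sin_div_halfNorm h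
  simp only [trajA, div_eq_mul_inv _ (2 : ℂ)]
  exact (hc.fun_add (((h0.mul_const 2⁻¹).const_mul Complex.I).fun_mul hs)).fun_mul
    ((((h0.mul_const 2⁻¹).mul_const _).const_mul Complex.I).fun_neg.cexp)

theorem differentiableAt_trajB {μ : Covector} (h : halfNorm μ ≠ 0) :
    DifferentiableAt ℝ (fun ν => trajB ν 1) μ := by
  have h0 := differentiableAt_ofReal_comp (differentiableAt_coord 0 μ)
  have h1 := differentiableAt_ofReal_comp (differentiableAt_coord 1 μ)
  have h2 := differentiableAt_ofReal_comp (differentiableAt_coord 2 μ)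
  have hs := differentiableAt_sin_div_halfNorm h
  simp only [trajB, div_eq_mul_inv _ (2 : ℂ)]
  exact (((h1.fun_add (h2.const_mul Complex.I)).mul_const 2⁻¹).fun_mul hs).fun_mul
    ((((h0.mul_const 2⁻¹).mul_const _).const_mul Complex.I).cexp)

theorem differentiableAt_trajMatrix {μ : Covector} (h : halfNorm μ ≠ 0) (i j : Fin 2) :
    DifferentiableAt ℝ (fun ν => trajMatrix ν 1 i j) μ := by
  have hA := differentiableAt_trajA h
  have hB := differentiableAt_trajB h
  fin_cases i <;> fin_cases j
  · exact hA
  · exact hB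
  · exact hB.star.fun_neg
  · exact hA.star

theorem differentiableAt_srExp (q : SU2) {μ : Covector} (h : halfNorm μ ≠ 0) :
    DifferentiableAt ℝ (fun ν (i j : Fin 2) => (srExp q ν : Mat2) i j) μ := by
  refine differentiableAt_pi.mpr fun i => differentiableAt_pi.mpr fun j => ?_
  simp only [srExp_eq, Submonoid.coe_mul, Matrix.mul_apply]
  exact DifferentiableAt.fun_sum fun k _ => (differentiableAt_trajMatrix h k j).const_mul _

/-- Along a vector in the kernel of the differential of the exponential map, the trajectory matrix
has derivative zero. -/
theorem hasDerivAt_trajMatrix_of_ker (q : SU2) {μ v : Covector} (h : halfNorm μ ≠ 0)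
    (hv : srExpDifferential q μ v = 0) (i j : Fin 2) :
    HasDerivAt (fun t : ℝ => trajMatrix (μ + t • v) 1 i j) 0 0 := by
  have hline : HasDerivAt (fun t : ℝ => μ + t • v) v 0 := by
    simpa using ((hasDerivAt_id (0 : ℝ)).smul_const v).const_add μ
  have hF : HasFDerivAt (fun ν (i j : Fin 2) => (srExp q ν : Mat2) i j)
      (srExpDifferential q μ) (μ + (0 : ℝ) • v) := by
    rw [zero_smul, add_zero]
    exact (differentiableAt_srExp q h).hasFDerivAt
  have hd := hF.comp_hasDerivAt (0 : ℝ) hline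
  rw [hv] at hd
  have hij := fun k => hasDerivAt_pi.mp (hasDerivAt_pi.mp hd k) j
  have hq : star (q : Mat2) * (q : Mat2) = 1 :=
    Matrix.mem_unitaryGroup_iff'.mp (Matrix.mem_specialUnitaryGroup_iff.mp q.2).1
  -- Multiplying by `q*` undoes the left translation.
  have hf : (fun t : ℝ => trajMatrix (μ + t • v) 1 i j) =
      fun t : ℝ => ∑ k, star (q : Mat2) i k * (srExp q (μ + t • v) : Mat2) k j := by
    ext t
    rw [← Matrix.mul_apply, srExp_eq, Submonoid.coe_mul, ← mul_assoc, hq, one_mul]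
  rw [hf]
  refine (HasDerivAt.fun_sum fun k _ => (hij k).const_mul (star (q : Mat2) i k)).congr_deriv ?_
  simp

/-- With the common phase factored out, vanishing of the derivative becomes two real equations
linear in `x'` and `w'`. -/
theorem hasDerivAt_planarMap {x w : ℝ → ℝ} {x' w' t : ℝ} (hx : HasDerivAt x x' t)
    (hw : HasDerivAt w w' t) (h : w t ≠ 0) :
    HasDerivAt (fun s => planarMap (x s, w s))
      ((((-Real.sin (w t) * w' + x t * (Real.sin (w t) / w t) * x' : ℝ) : ℂ) + Complex.I *
        ((x' * (Real.sin (w t) / w t) +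
          x t * ((Real.cos (w t) * w t - Real.sin (w t)) / w t ^ 2 * w') -
          Real.cos (w t) * x' : ℝ) : ℂ)) * Complex.exp (-(Complex.I * x t))) t := by
  have hS := ((hw.sin.fun_div hw h).ofReal_comp)
  have hX := hx.ofReal_comp
  have hC := hw.cos.ofReal_comp
  have hE := (hX.const_mul Complex.I).fun_neg.cexp
  simp only [planarMap, ← Complex.ofReal_div]
  refine ((hC.fun_add ((hX.const_mul Complex.I).fun_mul hS)).fun_mul hE).congr_deriv ?_
  have hI := Complex.I_sq
  push_cast
  generalize Complex.I = I at *
  have hw0 : (w t : ℂ) ≠ 0 := by exact_mod_cast h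
  field_simp
  linear_combination -(Complex.sin (w t) * x t * x' * w t) * hI

/-- The planar map is an immersion off its critical lines. -/
theorem eq_zero_of_hasDerivAt_planarMap {x w : ℝ → ℝ} {x' w' t : ℝ} (hx : HasDerivAt x x' t)
    (hw : HasDerivAt w w' t) (h : |x t| < w t) (hs : Real.sin (w t) ≠ 0)
    (hc : Real.sin (w t) ≠ w t * Real.cos (w t))
    (h0 : HasDerivAt (fun s => planarMap (x s, w s)) 0 t) : x' = 0 ∧ w' = 0 := by
  have hw0 : 0 < w t := (abs_nonneg _).trans_lt h
  have hsq : 0 < w t ^ 2 - x t ^ 2 :=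
    sub_pos.mpr (sq_lt_sq.mpr (h.trans_le (le_abs_self _)))
  have e := (hasDerivAt_planarMap hx hw hw0.ne').unique h0
  rw [mul_eq_zero, or_iff_left (Complex.exp_ne_zero _)] at e
  have e1 := congrArg Complex.re e
  have e2 := congrArg Complex.im e
  simp only [Complex.add_re, Complex.add_im, Complex.ofReal_re, Complex.ofReal_im, Complex.mul_re,
    Complex.mul_im, Complex.I_re, Complex.I_im, Complex.zero_re, Complex.zero_im,
    zero_mul, one_mul, mul_zero, sub_zero, add_zero, zero_add] at e1 e2
  generalize Real.sin (w t) = S at *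
  generalize Real.cos (w t) = C at *
  generalize w t = W at *
  generalize x t = X at *
  have hW := hw0.ne'
  field_simp at e1 e2
  have e1' : W * w' = X * x' := by
    apply mul_left_cancel₀ hs
    linear_combination -e1
  -- Eliminating `w'` exposes the determinant: its factors vanish only on the critical lines and
  -- where `|x| = w`.
  have e2' : (S - W * C) * (W ^ 2 - X ^ 2) * x' = 0 := by
    linear_combination W * e2 - X * (C * W - S) * e1'
  have hx' : x' = 0 := by
    rcases mul_eq_zero.mp e2' with h | h
    · exact absurd h (mul_ne_zero (sub_ne_zero.mpr hc) hsq.ne')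
    · exact h
  refine ⟨hx', ?_⟩
  rw [hx', mul_zero] at e1'
  exact (mul_eq_zero.mp e1').resolve_left hW

theorem abs_lt_halfNorm {μ : Covector} (hz : (μ 1 + Complex.I * μ 2 : ℂ) ≠ 0) :
    |μ 0 / 2| < halfNorm μ := by
  have h4 := four_mul_halfNorm_sq μ
  have hpos : 0 < μ 1 ^ 2 + μ 2 ^ 2 := by
    by_contra! hle
    have h1 : μ 1 = 0 := by nlinarith [sq_nonneg (μ 1), sq_nonneg (μ 2)]
    have h2 : μ 2 = 0 := by nlinarith [sq_nonneg (μ 1), sq_nonneg (μ 2)]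
    exact hz (by simp [h1, h2])
  refine abs_lt_of_sq_lt_sq ?_ (halfNorm_nonneg μ)
  linarith [div_pow (μ 0) 2 2]

/-- Conjugate covectors with nonzero horizontal part. -/
theorem critical_of_mem_conjugateLocus {q : SU2} {μ : Covector} (hμ : μ ∈ conjugateLocus q)
    (hz : (μ 1 + Complex.I * μ 2 : ℂ) ≠ 0) (hs : Real.sin (halfNorm μ) ≠ 0) :
    Real.sin (halfNorm μ) = halfNorm μ * Real.cos (halfNorm μ) := by
  obtain ⟨-, v, hv, hker⟩ := hμ
  by_contra hc
  have hlt := abs_lt_halfNorm hz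
  have hw : halfNorm μ ≠ 0 := ((abs_nonneg _).trans_lt hlt).ne'
  have hA : HasDerivAt (fun t : ℝ => trajA (μ + t • v) 1) 0 0 :=
    hasDerivAt_trajMatrix_of_ker q hw hker 0 0
  have hB : HasDerivAt (fun t : ℝ => trajB (μ + t • v) 1) 0 0 :=
    hasDerivAt_trajMatrix_of_ker q hw hker 0 1
  have hcoord : ∀ i, HasDerivAt (fun t : ℝ => (μ + t • v) i) (v i) 0 := fun i => by
    simpa using ((hasDerivAt_id (0 : ℝ)).mul_const (v i)).const_add (μ i)
  have h00 : μ + (0 : ℝ) • v = μ := by simp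
  have hN : HasDerivAt (fun t : ℝ => halfNorm (μ + t • v)) (fderiv ℝ halfNorm μ v) 0 := by
    have hline : HasDerivAt (fun t : ℝ => μ + t • v) v 0 := by
      simpa using ((hasDerivAt_id (0 : ℝ)).smul_const v).const_add μ
    have hF : HasFDerivAt halfNorm (fderiv ℝ halfNorm μ) (μ + (0 : ℝ) • v) := by
      rw [h00]
      exact (differentiableAt_halfNorm hw).hasFDerivAt
    exact hF.comp_hasDerivAt (0 : ℝ) hline
  simp only [trajA_one] at hA
  obtain ⟨hv0, hN0⟩ := eq_zero_of_hasDerivAt_planarMap ((hcoord 0).div_const 2) hN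
    (by rwa [h00]) (by rwa [h00]) (by rwa [h00]) hA
  rw [hN0] at hN
  have hS := ((hN.mul_const 1).sin.fun_div hN (by rwa [h00])).ofReal_comp
  have hZ := ((hcoord 1).ofReal_comp.fun_add
    ((hcoord 2).ofReal_comp.const_mul Complex.I)).div_const 2
  have hE := ((((hcoord 0).ofReal_comp.div_const 2).mul_const ((1 : ℝ) : ℂ)).const_mul
    Complex.I).cexp
  have hv0' : v 0 = 0 := by linarith
  -- Since `x` and `w` are stationary, the derivative of `B` is that of `z` times a nonzero factor,
  -- so `v` vanishes entirely.
  have hB' := (hZ.fun_mul hS).fun_mul hE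
  simp only [Complex.ofReal_div] at hB'
  have e := hB'.unique hB
  rw [hv0', h00] at e
  simp only [mul_one, mul_zero, zero_mul, sub_self, zero_div, Complex.ofReal_zero,
    add_zero, mul_eq_zero, Complex.exp_ne_zero, or_false, div_eq_zero_iff, Complex.ofReal_eq_zero,
    hs, hw, OfNat.ofNat_ne_zero] at e
  have e1 := congrArg Complex.re e
  have e2 := congrArg Complex.im e
  simp at e1 e2
  apply hv
  ext i
  fin_cases i
  · exact hv0'
  · exact e1
  · exact e2

/-- Three cases: `z = 0`, then `sin w = 0`, then the critical points of the planar map. Only the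
last calls on the differential. -/
theorem not_injOn_srExp {q : SU2} {μ : Covector} (hμ : μ ∈ conjugateLocus q) {U : Set Covector}
    (hU : U ∈ 𝓝 μ) : ¬ InjOn (srExp q) U := by
  by_cases hz : (μ 1 + Complex.I * μ 2 : ℂ) = 0
  · rw [← ofVertHoriz_self μ, hz] at hU
    exact not_injOn_srExp_vertical q _ hU
  have hnorm : √(μ 0 ^ 2 + ‖(μ 1 + Complex.I * μ 2 : ℂ)‖ ^ 2) / 2 = halfNorm μ := by
    rw [← halfNorm_ofVertHoriz, ofVertHoriz_self]
  by_cases hs : Real.sin (halfNorm μ) = 0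
  · rw [← hnorm] at hs
    rw [← ofVertHoriz_self μ] at hU
    exact not_injOn_srExp_of_sin_eq_zero q hz hs hU
  have hlt := abs_lt_halfNorm hz
  have hc := critical_of_mem_conjugateLocus hμ hz hs
  have hz' : ‖(μ 1 + Complex.I * μ 2 : ℂ)‖ ≠ 0 := norm_ne_zero_iff.mpr hz
  -- The phase `u = z / |z|` and the radius `2 √(w² - x²) = |z|` recover `μ` as the base point of
  -- the lift.
  refine not_injOn_srExp_of_planarMap q
    (u := (μ 1 + Complex.I * μ 2) / ‖(μ 1 + Complex.I * μ 2 : ℂ)‖) ?_ hlt hs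
    (fun N hN => not_injOn_planarMap hlt hs hc hN) ?_
  · rw [norm_div, Complex.norm_real, norm_norm, div_self hz']
  · have hr : 2 * √(halfNorm μ ^ 2 - (μ 0 / 2) ^ 2) = ‖(μ 1 + Complex.I * μ 2 : ℂ)‖ := by
      rw [← hnorm, div_pow, Real.sq_sqrt (by positivity), div_pow, ← sub_div, add_sub_cancel_left,
        Real.sqrt_div (by positivity), Real.sqrt_sq (norm_nonneg _),
        Real.sqrt_sq (by norm_num)]
      ring
    rw [hr, mul_div_cancel₀ _ two_ne_zero, mul_div_cancel₀ _ (by exact_mod_cast norm_ne_zero_iff.mpr hz),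
      ofVertHoriz_self]
    exact hU

end SubRiemannianSU2

theorem mainTheorem8 (q : SubRiemannianSU2.SU2) :
    SubRiemannianSU2.expDomain q = Set.univ ∧
    ∀ μ ∈ SubRiemannianSU2.conjugateLocus q, ∀ U ∈ nhds μ,
      ¬ Set.InjOn (SubRiemannianSU2.srExp q) U :=
  ⟨SubRiemannianSU2.expDomain_eq_univ q, fun _ hμ _ hU => SubRiemannianSU2.not_injOn_srExp hμ hU⟩
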